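/- Let $T$ be a tree with $n\ge 4$ vertices whose complement $T^c$ is connected (equivalently, $T$ is not a star). For a connected graph $G$, the eccentricity matrix $\mathcal{E}(G)$ has $(u,v)$-entry $d_G(u,v)$ if $d_G(u,v)=\min\{e_G(u),e_G(v)\}$ and $0$ otherwise, where $e_G(u)=\max_v d_G(u,v)$; let $\xi_2(G)$ denote the second largest eigenvalue of $\mathcal{E}(G)$. For $d\ge 4$, $a,b\ge 0$ and $n=d+1+a+b$, let $T_{n,d}^{a,b}$ be the tree obtained from the path $v_0v_1\cdots v_d$ by attaching $a$ pendant vertices to $v_1$ and $b$ pendant vertices to $v_{d-1}$. (1) If $T$ is not isomorphic to $T_{n,5}^{s-1,s-1}$ for any integer $s\ge 1$ (where $n=2s+4$), then $\xi_2(T^c)\le\sqrt{2(n-3)}$. Equality holds if and only if $n=2s+3$ for some integer $s\ge 1$ and $T$ is isomorphic to one of $T_{n,4}^{s-1,s-1}$, $T_{n,5}^{s-2,s-1}$, $T_{n,6}^{s-2,s-2}$ (the last two being defined only for $s\ge 2$). (2) If $T\cong T_{n,5}^{s-1,s-1}$ for some integer $s\ge 1$ (so $n=2s+4$), then $\xi_2(T^c)=2x>\sqrt{2(n-3)}$,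 where $x$ is the unique positive root of the equation $x^3+x^2-(s+1)x-s=0$. -/

import Mathlib

/-- The eccentricity matrix of a (connected) graph `G`: the `(u, v)` entry is `d(u, v)` if
`d(u, v) = min (e(u), e(v))`, and `0` otherwise. -/
noncomputable def eccMatrix {V : Type*} (G : SimpleGraph V) : Matrix V V ℝ :=
  open Classical in
  Matrix.of fun u v => if G.edist u v = min (G.eccent u) (G.eccent v) then (G.dist u v : ℝ) else 0

theorem eccMatrix_isHermitian {V : Type*} (G : SimpleGraph V) : (eccMatrix G).IsHermitian := by
  ext u v
  simp [eccMatrix, Matrix.conjTranspose_apply, SimpleGraph.edist_comm (u := v) (v := u),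
    SimpleGraph.dist_comm (u := v) (v := u), min_comm (G.eccent v)]

/-- The second largest eigenvalue `ξ₂(G)` of the eccentricity matrix of a graph `G` with at least
two vertices (eigenvalues are listed in decreasing order with multiplicity, indexed from `0`). -/
noncomputable def xiTwo {V : Type*} [Fintype V] [DecidableEq V] (G : SimpleGraph V)
    (h : 1 < Fintype.card V) : ℝ :=
  (eccMatrix_isHermitian G).eigenvalues₀ ⟨1, h⟩

/-- The tree `T_{n,d}^{a,b}` (for `d ≥ 3`, with `n = d + 1 + a + b`), obtained from the path
`v₀ v₁ … v_d` by attaching `a` pendant vertices to `v₁` and `b` pendant vertices to `v_{d-1}`. -/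
def doubleBroom (d a b : ℕ) : SimpleGraph (Fin (d + 1) ⊕ (Fin a ⊕ Fin b)) :=
  SimpleGraph.fromRel fun x y =>
    match x, y with
    | .inl i, .inl j => (i : ℕ) + 1 = j
    | .inl i, .inr (.inl _) => (i : ℕ) = 1
    | .inl i, .inr (.inr _) => (i : ℕ) + 1 = d
    | .inr _, _ => False

/-! In `Tᶜ` a non-edge of `T` has distance at most 1 and every vertex has eccentricity at least 2,
so the eccentricity matrix is supported on the edges of `T`. Its entry is 2 on every edge, except on
a dominating edge (`T` a double star), where only the bound "at least 2" is needed. The problem is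
thus essentially about twice the second adjacency eigenvalue of a tree.

Upper bounds come from Courant–Fischer: a bound for the quadratic form on one hyperplane bounds
`ξ₂`. On the hyperplane the form is estimated edge by edge by `2ab ≤ h a² + h⁻¹ b²`, with reciprocal
weights on the two directions of an edge; if the weights leaving each vertex sum to at most `θ`, the
form is at most `2θ|x|²` (`eigenvector_of_weights`).

For odd `n = 2s + 3`, the hyperplane is `x r = 0` at a centroid `r`, and the weights are branch
sizes over `θ = √s` (`xiTwo_compl_of_branchCard_le`). Equality forces an eigenvector along which
every inequality is tight, and this dictates the branch sizes and hence the tree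
(`iso_of_xiTwo_compl_eq`). For even `n = 2m`, a centroid with all branches below half leaves room to
spare. Otherwise an edge `uw` halves the tree; the hyperplane then ties `x u` to `x w` with opposite
signs, and negative weights on `uw` save enough unless the half is a star with leaf `u`
(`xiTwo_compl_lt_of_balanced_edge`). If both halves are such stars, `T` is the exceptional tree.

Lower bounds come from explicit sign-changing eigenvectors (`le_second_eigenvalue_of_sign_change`).
For the exceptional tree the same eigenvector supplies the weights for the matching upper bound
(`xiTwo_compl_le_of_eigenvector`). -/

/-! ### Variational bounds for the second largest eigenvalue -/

open Matrix in
/-- The two largest eigenvalues of a Hermitian matrix with orthonormal eigenvectors, together with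
the bound of the quadratic form on the orthogonal complement of the first one. -/
theorem exists_top_eigenvectors {V : Type*} [Fintype V] [DecidableEq V] {M : Matrix V V ℝ}
    (hM : M.IsHermitian) (h : 1 < Fintype.card V) :
    ∃ (a : ℝ) (f₀ f₁ : V → ℝ), hM.eigenvalues₀ ⟨1, h⟩ ≤ a ∧ f₀ ⬝ᵥ f₀ = 1 ∧ f₁ ⬝ᵥ f₁ = 1 ∧
      f₀ ⬝ᵥ f₁ = 0 ∧ M *ᵥ f₀ = a • f₀ ∧ M *ᵥ f₁ = hM.eigenvalues₀ ⟨1, h⟩ • f₁ ∧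
      ∀ x : V → ℝ, f₀ ⬝ᵥ x = 0 → x ⬝ᵥ M *ᵥ x ≤ hM.eigenvalues₀ ⟨1, h⟩ * (x ⬝ᵥ x) := by
  -- This is the enumeration used in the definition of `eigenvalues`, so it translates between
  -- `eigenvalues` and `eigenvalues₀`.
  set e : Fin (Fintype.card V) ≃ V := Fintype.equivOfCardEq (Fintype.card_fin _) with he
  have hev : ∀ i, hM.eigenvalues (e i) = hM.eigenvalues₀ i := fun i => by
    simp [Matrix.IsHermitian.eigenvalues, he]
  set w : V → V → ℝ := fun i => ⇑(hM.eigenvectorBasis i) with hw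
  have hin : ∀ x y : EuclideanSpace ℝ V, inner ℝ x y = (x : V → ℝ) ⬝ᵥ (y : V → ℝ) := fun x y => by
    rw [EuclideanSpace.inner_eq_star_dotProduct, dotProduct_comm]; simp
  have hon : ∀ i j, w i ⬝ᵥ w j = if i = j then 1 else 0 := fun i j => by
    rw [hw, ← hin]; exact orthonormal_iff_ite.1 hM.eigenvectorBasis.orthonormal i j
  have hMw : ∀ i, M *ᵥ w i = hM.eigenvalues i • w i := hM.mulVec_eigenvectorBasis
  have h01 : e ⟨0, by omega⟩ ≠ e ⟨1, h⟩ := by simp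
  refine ⟨hM.eigenvalues₀ ⟨0, by omega⟩, w (e ⟨0, by omega⟩), w (e ⟨1, h⟩),
    hM.eigenvalues₀_antitone (by simp [Fin.le_def]), by simp [hon], by simp [hon],
    by rw [hon, if_neg h01], by rw [hMw, hev], by rw [hMw, hev], fun x hx => ?_⟩
  have hexp : x = ∑ i, (w i ⬝ᵥ x) • w i := by
    have := hM.eigenvectorBasis.sum_repr' (WithLp.toLp 2 x)
    have h2 := congrArg (WithLp.ofLp) this
    simp only [hin] at h2
    rw [WithLp.ofLp_sum] at h2
    exact h2.symm
  have hxx : ∀ y : V → ℝ, y ⬝ᵥ x = ∑ i, (w i ⬝ᵥ x) * (y ⬝ᵥ w i) := fun y => by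
    conv_lhs => rw [hexp]
    simp [dotProduct_sum, dotProduct_smul]
  have h1 : x ⬝ᵥ x = ∑ i, (w i ⬝ᵥ x) ^ 2 := by
    rw [hxx x]; exact Finset.sum_congr rfl fun i _ => by rw [dotProduct_comm x, sq]
  have h2 : x ⬝ᵥ M *ᵥ x = ∑ i, hM.eigenvalues i * (w i ⬝ᵥ x) ^ 2 := by
    rw [dotProduct_mulVec, hxx]
    refine Finset.sum_congr rfl fun i _ => ?_
    rw [← dotProduct_mulVec, hMw, dotProduct_smul, dotProduct_comm x, smul_eq_mul]; ring
  rw [h1, h2, Finset.mul_sum]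
  refine Finset.sum_le_sum fun i _ => ?_
  by_cases hi : i = e ⟨0, by omega⟩
  · rw [hi, hx]; simp
  · refine mul_le_mul_of_nonneg_right ?_ (sq_nonneg _)
    obtain ⟨j, rfl⟩ := e.surjective i
    rw [hev]
    refine hM.eigenvalues₀_antitone ?_
    have : j.1 ≠ 0 := fun hj => hi (by congr 1; exact Fin.ext hj)
    simp only [Fin.le_def]; omega

open Matrix in
/-- If the quadratic form of `M` is at most `μ` on a hyperplane, then the second largest eigenvalue
is at most `μ`, and in case of equality the hyperplane contains an eigenvector. -/
theorem eigenvector_of_form_le_on_hyperplane {V : Type*} [Fintype V] [DecidableEq V]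
    {M : Matrix V V ℝ} (hM : M.IsHermitian) (h : 1 < Fintype.card V) (ψ : (V → ℝ) →ₗ[ℝ] ℝ) {μ : ℝ}
    (hψ : ∀ x, ψ x = 0 → x ⬝ᵥ M *ᵥ x ≤ μ * (x ⬝ᵥ x)) (hμ : μ ≤ hM.eigenvalues₀ ⟨1, h⟩) :
    hM.eigenvalues₀ ⟨1, h⟩ = μ ∧ ∃ x, x ≠ 0 ∧ ψ x = 0 ∧ M *ᵥ x = μ • x := by
  obtain ⟨a, f₀, f₁, ha, h00, h11, h01, hf₀, hf₁, -⟩ := exists_top_eigenvectors hM h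
  have h10 : f₁ ⬝ᵥ f₀ = 0 := by rw [dotProduct_comm, h01]
  set b := hM.eigenvalues₀ ⟨1, h⟩
  -- The span of the top two eigenvectors is a plane, so it meets the hyperplane nontrivially. There
  -- the form is at least the second eigenvalue times the squared norm.
  obtain ⟨α, β, hαβ, hne⟩ : ∃ α β : ℝ, α * ψ f₀ + β * ψ f₁ = 0 ∧ α ^ 2 + β ^ 2 ≠ 0 := by
    by_cases h0 : ψ f₀ = 0
    · exact ⟨1, 0, by simp [h0], by norm_num⟩
    · refine ⟨-ψ f₁, ψ f₀, by ring, ?_⟩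
      have : 0 < ψ f₀ ^ 2 := by positivity
      positivity
  set x := α • f₀ + β • f₁ with hx
  have hMx : M *ᵥ x = (α * a) • f₀ + (β * b) • f₁ := by
    simp [hx, mulVec_add, mulVec_smul, hf₀, hf₁, smul_smul]
  have hxx : x ⬝ᵥ x = α ^ 2 + β ^ 2 := by
    simp [hx, h00, h11, h01, h10]; ring
  have hq := hψ x (by simpa [hx] using hαβ)
  have hxM : x ⬝ᵥ M *ᵥ x = α ^ 2 * a + β ^ 2 * b := by
    rw [hMx]; simp [hx, h00, h11, h01, h10]; ring
  rw [hxx, hxM] at hq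
  have t1 : 0 ≤ α ^ 2 * (a - μ) := mul_nonneg (sq_nonneg _) (by linarith)
  have t2 : 0 ≤ β ^ 2 * (b - μ) := mul_nonneg (sq_nonneg _) (by linarith)
  have e1 : α ^ 2 * (a - μ) = 0 := by linarith
  have e2 : β ^ 2 * (b - μ) = 0 := by linarith
  have e1' : α * a = μ * α := by
    rcases mul_eq_zero.1 e1 with h | h
    · simp [pow_eq_zero_iff two_ne_zero |>.1 h]
    · rw [sub_eq_zero.1 h, mul_comm]
  have e2' : β * b = μ * β := by
    rcases mul_eq_zero.1 e2 with h | h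
    · simp [pow_eq_zero_iff two_ne_zero |>.1 h]
    · rw [sub_eq_zero.1 h, mul_comm]
  refine ⟨?_, x, fun h0 => hne (by rw [← hxx, h0]; simp), by simpa [hx] using hαβ, ?_⟩
  · rcases mul_eq_zero.1 e2 with h | h
    · rcases mul_eq_zero.1 e1 with h' | h'
      · exact absurd (by rw [h, h', add_zero]) hne
      · linarith
    · linarith
  · rw [hMx, e1', e2', hx, smul_add, smul_smul, smul_smul]

open Matrix in
/-- An eigenvector of an entrywise nonnegative symmetric matrix that changes sign has an
eigenvalue that is at most the second largest one. -/
theorem le_second_eigenvalue_of_sign_change {V : Type*} [Fintype V] [DecidableEq V]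
    {M : Matrix V V ℝ} (hM : M.IsHermitian) (h : 1 < Fintype.card V) (hnn : ∀ u v, 0 ≤ M u v)
    {μ : ℝ} {f : V → ℝ} (hf : M *ᵥ f = μ • f) {p q : V} (hp : 0 < f p) (hq : f q < 0) :
    μ ≤ hM.eigenvalues₀ ⟨1, h⟩ := by
  obtain ⟨a, f₀, f₁, -, -, -, -, -, -, hx⟩ := exists_top_eigenvectors hM h
  set g : V → ℝ := fun v => |f v| with hg
  -- On the span of `f` and `|f|` the form is at least `μ` times the squared norm; this picks a
  -- combination orthogonal to the top eigenvector.
  obtain ⟨α, β, hαβ, hne⟩ : ∃ α β : ℝ, α * (f₀ ⬝ᵥ f) + β * (f₀ ⬝ᵥ g) = 0 ∧ (α ≠ 0 ∨ β ≠ 0) := by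
    by_cases h0 : f₀ ⬝ᵥ f = 0
    · exact ⟨1, 0, by simp [h0], by norm_num⟩
    · exact ⟨-(f₀ ⬝ᵥ g), f₀ ⬝ᵥ f, by ring, Or.inr h0⟩
  set x := α • f + β • g with hxd
  have hq' := hx x (by simpa [hxd] using hαβ)
  have hgf : g ⬝ᵥ f = f ⬝ᵥ g := dotProduct_comm _ _
  have hgMf : g ⬝ᵥ M *ᵥ f = μ * (f ⬝ᵥ g) := by rw [hf, dotProduct_smul, hgf, smul_eq_mul]
  have hfMg : f ⬝ᵥ M *ᵥ g = μ * (f ⬝ᵥ g) := by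
    rw [dotProduct_mulVec, ← mulVec_transpose, show Mᵀ = M from hM, hf, smul_dotProduct,
      smul_eq_mul]
  have hgg : μ * (g ⬝ᵥ g) ≤ g ⬝ᵥ M *ᵥ g := by
    rw [dotProduct, dotProduct, Finset.mul_sum]
    refine Finset.sum_le_sum fun v _ => ?_
    have h1 : μ * g v ≤ (M *ᵥ g) v := by
      calc μ * g v ≤ |μ * f v| := by
            rw [abs_mul]; exact mul_le_mul_of_nonneg_right (le_abs_self _) (abs_nonneg _)
        _ = |(M *ᵥ f) v| := by rw [hf]; rfl
        _ ≤ ∑ u, |M v u * f u| := Finset.abs_sum_le_sum_abs _ _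
        _ = (M *ᵥ g) v := by
            refine Finset.sum_congr rfl fun u _ => ?_
            rw [abs_mul, abs_of_nonneg (hnn v u)]
    nlinarith [abs_nonneg (f v)]
  have hxM : μ * (x ⬝ᵥ x) ≤ x ⬝ᵥ M *ᵥ x := by
    have e1 : x ⬝ᵥ x = α ^ 2 * (f ⬝ᵥ f) + 2 * α * β * (f ⬝ᵥ g) + β ^ 2 * (g ⬝ᵥ g) := by
      simp [hxd, hgf]; ring
    have e2 : x ⬝ᵥ M *ᵥ x = α ^ 2 * (μ * (f ⬝ᵥ f)) + 2 * α * β * (μ * (f ⬝ᵥ g))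
        + β ^ 2 * (g ⬝ᵥ M *ᵥ g) := by
      have : f ⬝ᵥ M *ᵥ f = μ * (f ⬝ᵥ f) := by rw [hf, dotProduct_smul, smul_eq_mul]
      simp [hxd, mulVec_add, mulVec_smul, this, hgMf, hfMg]; ring
    rw [e1, e2]
    nlinarith [mul_le_mul_of_nonneg_left hgg (sq_nonneg β)]
  -- The sign change makes `f` and `|f|` linearly independent: compare the values at `p` and `q`.
  have hpos : 0 < x ⬝ᵥ x := by
    refine lt_of_le_of_ne (Finset.sum_nonneg fun v _ => mul_self_nonneg _) fun h0 => ?_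
    have h0' := dotProduct_self_eq_zero.1 h0.symm
    have hP := congrFun h0' p
    have hQ := congrFun h0' q
    simp only [hxd, hg, Pi.add_apply, Pi.smul_apply, smul_eq_mul, Pi.zero_apply, abs_of_pos hp,
      abs_of_neg hq] at hP hQ
    have s1 : α + β = 0 := by
      have : (α + β) * f p = 0 := by linarith
      exact (mul_eq_zero.1 this).resolve_right hp.ne'
    have s2 : α - β = 0 := by
      have : (α - β) * f q = 0 := by linarith
      exact (mul_eq_zero.1 this).resolve_right hq.ne
    rcases hne with h | h <;> apply h <;> linarith
  exact le_of_mul_le_mul_right (hxM.trans hq') hpos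

/-! ### Branches and centroids of a tree -/

namespace SimpleGraph

section Branch

variable {V : Type*} {T : SimpleGraph V}

theorem Connected.exists_adj_dist_lt (hT : T.Connected) {u w : V} (h : w ≠ u) :
    ∃ v, T.Adj u v ∧ T.dist w v < T.dist w u := by
  obtain ⟨p, hp⟩ := hT.exists_walk_length_eq_dist u w
  cases p with
  | nil => exact absurd rfl h
  | @cons _ v _ huv p =>
    refine ⟨v, huv, ?_⟩
    rw [dist_comm, T.dist_comm (u := w), ← hp, Walk.length_cons]
    exact Nat.lt_succ_of_le (dist_le p)

/-- Either neighbour extends to a shortest path from `u` to `w`, and paths in a tree are unique. -/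
theorem IsTree.eq_of_adj_of_dist_lt (hT : T.IsTree) {u v v' w : V} (hv : T.Adj u v)
    (hv' : T.Adj u v') (h : T.dist w v < T.dist w u) (h' : T.dist w v' < T.dist w u) : v = v' := by
  obtain ⟨p, hp⟩ := hT.connected.exists_walk_length_eq_dist v w
  obtain ⟨p', hp'⟩ := hT.connected.exists_walk_length_eq_dist v' w
  have key : ∀ {x : V} (hx : T.Adj u x) (q : T.Walk x w), q.length = T.dist x w →
      T.dist w x < T.dist w u → (Walk.cons hx q).IsPath := fun {x} hx q hq hlt => by
    refine Walk.isPath_of_length_eq_dist _ (le_antisymm ?_ (dist_le _))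
    rw [Walk.length_cons, hq, dist_comm, T.dist_comm (u := u)]
    exact hlt
  have := (hT.isAcyclic.subsingleton_path u w).elim ⟨_, key hv p hp h⟩ ⟨_, key hv' p' hp' h'⟩
  have h2 := congrArg (fun q : T.Path u w => q.1.snd) this
  simpa using h2

/-- The number of vertices of `T` in the branch at `u` that starts with the edge from `u` to `v`
(`0` if `u` and `v` are not adjacent). -/
noncomputable def branchCard (T : SimpleGraph V) (u v : V) : ℕ :=
  {w | T.Adj u v ∧ T.dist w v < T.dist w u}.ncard

theorem branchCard_of_not_adj {u v : V} (h : ¬ T.Adj u v) : T.branchCard u v = 0 := by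
  simp [branchCard, h]

/-- Propagation of a property along the edges of a connected graph. -/
theorem Connected.forall_of_adj {P : V → Prop} (hT : T.Connected) {r : V} (hr : P r)
    (h : ∀ u v, T.Adj u v → P u → P v) (v : V) : P v := by
  obtain ⟨p⟩ := hT.preconnected r v
  induction p with
  | nil => exact hr
  | cons huv p ih => exact ih (h _ _ huv hr)

variable [Fintype V]

theorem branchCard_pos {u v : V} (h : T.Adj u v) : 0 < T.branchCard u v := by
  rw [branchCard, Set.ncard_pos]
  exact ⟨v, h, by rw [dist_self, dist_comm, dist_eq_one_iff_adj.2 h]; exact one_pos⟩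

/-- In a tree no vertex is equidistant from the two ends of an edge, so the two branches are
complementary. -/
theorem IsTree.branchCard_add (hT : T.IsTree) {u v : V} (h : T.Adj u v) :
    T.branchCard u v + T.branchCard v u = Fintype.card V := by
  have : {w | T.Adj v u ∧ T.dist w u < T.dist w v} =
      {w | T.Adj u v ∧ T.dist w v < T.dist w u}ᶜ := by
    ext w
    have := hT.dist_ne_of_adj w h
    simp only [h, h.symm, true_and, Set.mem_ofPred_eq, Set.mem_compl_iff]
    omega
  rw [branchCard, branchCard, this, Set.ncard_add_ncard_compl, Nat.card_eq_fintype_card]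

theorem IsTree.sum_branchCard (hT : T.IsTree) (u : V) :
    ∑ v, T.branchCard u v + 1 = Fintype.card V := by
  classical
  have h1 : ∀ v, T.branchCard u v =
      ∑ w, if T.Adj u v ∧ T.dist w v < T.dist w u then 1 else 0 := fun v => by
    rw [branchCard, ← Finset.card_filter, ← Set.ncard_coe_finset]
    simp
  have h2 : ∀ w, (∑ v, if T.Adj u v ∧ T.dist w v < T.dist w u then 1 else 0) =
      if w = u then 0 else 1 := fun w => by
    split_ifs with hw
    · subst hw; simp
    · obtain ⟨v, hv, hlt⟩ := hT.connected.exists_adj_dist_lt hw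
      rw [Finset.sum_eq_single v]
      · rw [if_pos ⟨hv, hlt⟩]
      · exact fun v' _ hne => if_neg fun h' => hne (hT.eq_of_adj_of_dist_lt h'.1 hv h'.2 hlt)
      · simp
  simp_rw [h1]
  rw [Finset.sum_comm]
  simp_rw [h2]
  rw [← Finset.sum_erase_add _ _ (Finset.mem_univ u), Finset.sum_congr rfl
    (fun w hw => if_neg (Finset.ne_of_mem_erase hw))]
  have := Fintype.card_pos_iff.2 ⟨u⟩
  simp; omega

/-- The branch at `p` through `v` consists of `v` and the branches at `v` away from `p`. -/
theorem IsTree.sum_branchCard_erase [DecidableEq V] (hT : T.IsTree) {p v : V} (h : T.Adj p v) :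
    ∑ w ∈ Finset.univ.erase p, T.branchCard v w + 1 = T.branchCard p v := by
  have h1 := hT.sum_branchCard v
  have h2 := hT.branchCard_add h
  rw [← Finset.sum_erase_add _ _ (Finset.mem_univ p)] at h1
  omega

theorem IsTree.branchCard_lt (hT : T.IsTree) {p v w : V} (h : T.Adj p v) (hw : w ≠ p) :
    T.branchCard v w < T.branchCard p v := by
  classical
  rw [← hT.sum_branchCard_erase h, Nat.lt_succ_iff]
  exact Finset.single_le_sum (f := fun w => T.branchCard v w) (fun _ _ => Nat.zero_le _)
    (Finset.mem_erase.2 ⟨hw, Finset.mem_univ w⟩)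

theorem IsTree.branchCard_add_le (hT : T.IsTree) {u v w : V} (h : v ≠ w) :
    T.branchCard u v + T.branchCard u w + 1 ≤ Fintype.card V := by
  classical
  rw [← hT.sum_branchCard u, ← Finset.sum_pair (f := T.branchCard u) h]
  exact Nat.add_le_add_right (Finset.sum_le_sum_of_subset (Finset.subset_univ _)) 1

/-- A tree has a centroid. -/
theorem IsTree.exists_centroid (hT : T.IsTree) :
    ∃ r, ∀ c, 2 * T.branchCard r c ≤ Fintype.card V := by
  by_contra! hcon
  -- Take an oversized branch of minimal size, at `u` through `c`. An oversized branch at `c` cannot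
  -- go back to `u`, so it lies strictly inside the first one.
  have hne : ∃ k, ∃ u c, Fintype.card V < 2 * T.branchCard u c ∧ T.branchCard u c = k := by
    obtain ⟨u⟩ := hT.connected.nonempty
    obtain ⟨c, hc⟩ := hcon u
    exact ⟨_, u, c, hc, rfl⟩
  classical
  obtain ⟨u, c, hc, hk⟩ := Nat.find_spec hne
  have huc : T.Adj u c := by
    by_contra h
    rw [branchCard_of_not_adj h] at hc; omega
  obtain ⟨d, hd⟩ := hcon c
  have hdu : d ≠ u := by
    rintro rfl
    have := hT.branchCard_add huc
    omega
  exact Nat.find_min hne (hk ▸ hT.branchCard_lt huc hdu) ⟨c, d, hd, rfl⟩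

end Branch

end SimpleGraph

/-! ### Distances and eccentricities in the complement -/

namespace SimpleGraph

section Complement

variable {V : Type*} {T : SimpleGraph V}

theorem IsTree.not_adj_of_adj_of_adj (hT : T.IsTree) {a b c : V} (hab : T.Adj a b)
    (hac : T.Adj a c) : ¬ T.Adj b c := fun hbc =>
  hT.dist_ne_of_adj a hbc (by rw [dist_eq_one_iff_adj.2 hab, dist_eq_one_iff_adj.2 hac])

/-- A tree contains no cycle of length four. -/
theorem IsTree.eq_of_common_neighbors (hT : T.IsTree) {a b x y : V} (hab : a ≠ b)
    (hax : T.Adj a x) (hbx : T.Adj b x) (hay : T.Adj a y) (hby : T.Adj b y) : x = y := by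
  have hnab : ¬ T.Adj a b := fun h => hT.not_adj_of_adj_of_adj hax.symm hbx.symm h
  have h2 := hT.connected.one_lt_dist_of_ne_of_not_adj hab hnab
  exact hT.eq_of_adj_of_dist_lt hbx hby (w := a)
    (by rw [dist_eq_one_iff_adj.2 hax]; exact h2) (by rw [dist_eq_one_iff_adj.2 hay]; exact h2)

/-- An edge such that every vertex is adjacent to one of its ends. -/
def IsDominatingEdge (T : SimpleGraph V) (u v : V) : Prop :=
  T.Adj u v ∧ ∀ w, T.Adj u w ∨ T.Adj v w

theorem IsDominatingEdge.symm {u v : V} (h : T.IsDominatingEdge u v) : T.IsDominatingEdge v u :=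
  ⟨h.1.symm, fun w => (h.2 w).symm⟩

/-- An end of a dominating edge is exactly a vertex of eccentricity above 2 in the complement. This
therefore rules out an edge at distance 2 whose ends both have larger eccentricity, which would have
matrix entry 0. -/
theorem IsTree.isDominatingEdge_of_both (hT : T.IsTree) {u v u' v' : V} (huv : T.Adj u v)
    (hu : T.IsDominatingEdge u v') (hv : T.IsDominatingEdge v u') : T.IsDominatingEdge u v := by
  by_cases h : v' = v
  · exact h ▸ hu
  by_cases h' : u' = u
  · exact (h' ▸ hv).symm
  exfalso
  rcases hv.2 v' with h1 | h1
  · exact hT.not_adj_of_adj_of_adj huv hu.1 h1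
  · exact h' (hT.eq_of_common_neighbors (Ne.symm h) huv.symm hu.1.symm hv.1 h1.symm).symm

/-- A vertex off a dominating edge is a leaf. -/
theorem IsTree.exists_branchCard_of_isDominatingEdge [Fintype V] (hT : T.IsTree) {a b r : V}
    (h : T.IsDominatingEdge a b) (ha : r ≠ a) (hb : r ≠ b) :
    ∃ c, T.branchCard r c + 1 = Fintype.card V := by
  wlog hra : T.Adj a r generalizing a b
  · exact this h.symm hb ha ((h.2 r).resolve_left hra)
  refine ⟨a, ?_⟩
  rw [← hT.sum_branchCard r, Finset.sum_eq_single a _ (by simp)]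
  intro w _ hwa
  refine branchCard_of_not_adj fun hrw => ?_
  rcases h.2 w with h1 | h1
  · exact hT.not_adj_of_adj_of_adj hra h1 hrw
  · exact hwa (hT.eq_of_common_neighbors (Ne.symm hb) h.1.symm hra.symm h1 hrw).symm

theorem two_le_edist_compl {u v : V} (h : T.Adj u v) : 2 ≤ Tᶜ.edist u v := by
  have h1 : ¬ Tᶜ.edist u v ≤ 1 := by
    rw [edist_le_one_iff_adj_or_eq, compl_adj]
    rintro (h' | h')
    · exact h'.2 h
    · exact h.ne h'
  rw [← one_add_one_eq_two]
  exact Order.add_one_le_of_lt (not_le.1 h1)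

theorem edist_compl_le_two {u v : V} (h : ¬ T.IsDominatingEdge u v) : Tᶜ.edist u v ≤ 2 := by
  by_cases huv : T.Adj u v
  · simp only [IsDominatingEdge, huv, true_and, not_forall, not_or] at h
    obtain ⟨w, hu, hv⟩ := h
    have h1 : Tᶜ.Adj u w := (compl_adj _ _ _).2 ⟨fun h => hv (h ▸ huv.symm), hu⟩
    have h2 : Tᶜ.Adj w v := (compl_adj _ _ _).2 ⟨fun h => hu (h ▸ huv), fun h => hv h.symm⟩
    exact edist_le (Walk.cons h1 (Walk.cons h2 Walk.nil))
  · refine le_trans (edist_le_one_iff_adj_or_eq.2 ?_) one_le_two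
    by_cases h : u = v
    · exact Or.inr h
    · exact Or.inl ((compl_adj _ _ _).2 ⟨h, huv⟩)

theorem two_lt_edist_compl {u v : V} (h : T.IsDominatingEdge u v) : 2 < Tᶜ.edist u v := by
  rw [two_lt_edist_iff]
  refine ⟨h.1.ne, fun h' => ((compl_adj _ _ _).1 h').2 h.1, ?_⟩
  rw [Set.eq_empty_iff_forall_notMem]
  intro w hw
  rw [mem_commonNeighbors, compl_adj, compl_adj] at hw
  rcases h.2 w with h' | h'
  · exact hw.1.2 h'
  · exact hw.2.2 h'

theorem Connected.two_le_eccent_compl [Nontrivial V] (hT : T.Connected) (u : V) :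
    2 ≤ Tᶜ.eccent u := by
  obtain ⟨w, hw⟩ := exists_ne u
  obtain ⟨v, hv, -⟩ := hT.exists_adj_dist_lt hw
  exact (two_le_edist_compl hv).trans edist_le_eccent

/-- A second dominating edge at `u` would create a 4-cycle in `T` through a vertex not adjacent to
`u`; such a vertex exists because `Tᶜ` is connected. -/
theorem IsDominatingEdge.eccent_compl {u v : V} (hT : T.IsTree) (hTc : Tᶜ.Connected)
    (h : T.IsDominatingEdge u v) : Tᶜ.eccent u = Tᶜ.edist u v := by
  refine le_antisymm ((eccent_le_iff _ _).2 fun w => ?_) edist_le_eccent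
  by_cases hw : w = v
  · rw [hw]
  refine (edist_compl_le_two fun hd => ?_).trans (two_lt_edist_compl h).le
  obtain ⟨x, hx, -⟩ := hTc.exists_adj_dist_lt h.1.ne'
  rw [compl_adj] at hx
  exact hx.1 (hT.eq_of_common_neighbors (Ne.symm hw) h.1.symm hd.1.symm
    ((h.2 x).resolve_left hx.2) ((hd.2 x).resolve_left hx.2))

end Complement
end SimpleGraph

/-! ### Entries of the eccentricity matrix of the complement -/

section EccMatrix

open SimpleGraph

variable {V : Type*} {T : SimpleGraph V}

theorem eccMatrix_compl_of_not_adj [Nontrivial V] (hT : T.IsTree) {u v : V} (h : ¬ T.Adj u v) :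
    eccMatrix Tᶜ u v = 0 := by
  have h1 : Tᶜ.edist u v ≤ 1 := by
    rw [edist_le_one_iff_adj_or_eq, compl_adj]
    by_cases h' : u = v
    · exact Or.inr h'
    · exact Or.inl ⟨h', h⟩
  rw [eccMatrix, Matrix.of_apply, if_neg]
  intro h2
  have h3 : (2 : ℕ∞) ≤ 1 := (le_min (hT.connected.two_le_eccent_compl u)
    (hT.connected.two_le_eccent_compl v)).trans (h2 ▸ h1)
  exact absurd h3 (by decide)

theorem eccMatrix_compl_of_isDominatingEdge (hT : T.IsTree) (hTc : Tᶜ.Connected) {u v : V}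
    (h : T.IsDominatingEdge u v) : 2 ≤ eccMatrix Tᶜ u v := by
  rw [eccMatrix, Matrix.of_apply, h.eccent_compl hT hTc, h.symm.eccent_compl hT hTc,
    Tᶜ.edist_comm (u := v), min_self, if_pos rfl]
  have := two_lt_edist_compl h
  rw [← (hTc u v).coe_dist_eq_edist] at this
  exact_mod_cast this.le

theorem eccMatrix_compl_of_not_isDominatingEdge [Nontrivial V] (hT : T.IsTree)
    (hTc : Tᶜ.Connected) {u v : V} (huv : T.Adj u v) (h : ¬ T.IsDominatingEdge u v) :
    eccMatrix Tᶜ u v = 2 := by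
  have h2 : Tᶜ.edist u v = 2 := le_antisymm (edist_compl_le_two h) (two_le_edist_compl huv)
  have h3 : min (Tᶜ.eccent u) (Tᶜ.eccent v) = 2 := by
    refine le_antisymm ?_ (le_min (hT.connected.two_le_eccent_compl u)
      (hT.connected.two_le_eccent_compl v))
    by_cases hu : ∃ w, T.IsDominatingEdge u w
    · refine (min_le_right _ _).trans
        ((eccent_le_iff _ _).2 fun w => edist_compl_le_two fun hw => ?_)
      obtain ⟨w', hw'⟩ := hu
      exact h (hT.isDominatingEdge_of_both huv hw' hw)
    · exact (min_le_left _ _).trans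
        ((eccent_le_iff _ _).2 fun w => edist_compl_le_two fun hw => hu ⟨w, hw⟩)
  rw [eccMatrix, Matrix.of_apply, h2, h3, if_pos rfl]
  have := (hTc u v).coe_dist_eq_edist
  rw [h2] at this
  exact_mod_cast this

theorem two_le_eccMatrix_compl [Nontrivial V] (hT : T.IsTree) (hTc : Tᶜ.Connected) {u v : V}
    (huv : T.Adj u v) : 2 ≤ eccMatrix Tᶜ u v := by
  by_cases h : T.IsDominatingEdge u v
  · exact eccMatrix_compl_of_isDominatingEdge hT hTc h
  · exact (eccMatrix_compl_of_not_isDominatingEdge hT hTc huv h).ge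

theorem eccMatrix_nonneg {V : Type*} (G : SimpleGraph V) (u v : V) : 0 ≤ eccMatrix G u v := by
  rw [eccMatrix, Matrix.of_apply]
  split_ifs <;> positivity

end EccMatrix

/-! ### Bounding a quadratic form by weights on ordered pairs -/

section Weights

variable {V : Type*} [Fintype V]

open Matrix in
-- Summing over ordered pairs gives each `x u ^ 2` twice the total weight leaving `u`, hence the
-- factor 2. If the final bound is attained, each pair inequality is tight, and so is the vertex
-- inequality wherever `x u ≠ 0`.
theorem form_le_sum_weights {M : Matrix V V ℝ} {g : V → V → ℝ} {θ : ℝ} {x : V → ℝ}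
    (hg : ∀ u v, M u v * x u * x v ≤ g u v * x u ^ 2 + g v u * x v ^ 2)
    (hs : ∀ u, ∑ v, g u v ≤ θ) :
    x ⬝ᵥ M *ᵥ x ≤ 2 * θ * (x ⬝ᵥ x) ∧ (2 * θ * (x ⬝ᵥ x) ≤ x ⬝ᵥ M *ᵥ x →
      (∀ u v, M u v * x u * x v = g u v * x u ^ 2 + g v u * x v ^ 2) ∧
        ∀ u, x u ≠ 0 → ∑ v, g u v = θ) := by
  have e1 : x ⬝ᵥ M *ᵥ x = ∑ u, ∑ v, M u v * x u * x v := by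
    simp only [dotProduct, mulVec, Finset.mul_sum]
    exact Finset.sum_congr rfl fun u _ => Finset.sum_congr rfl fun v _ => by ring
  have e2 : ∑ u, ∑ v, (g u v * x u ^ 2 + g v u * x v ^ 2) = ∑ u, 2 * ((∑ v, g u v) * x u ^ 2) := by
    simp_rw [Finset.sum_add_distrib]
    rw [Finset.sum_comm (f := fun u v => g v u * x v ^ 2), ← Finset.sum_add_distrib]
    refine Finset.sum_congr rfl fun u _ => ?_
    rw [Finset.sum_mul]; ring
  have e3 : 2 * θ * (x ⬝ᵥ x) = ∑ u, 2 * (θ * x u ^ 2) := by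
    rw [dotProduct, Finset.mul_sum]
    exact Finset.sum_congr rfl fun u _ => by ring
  have l0 : ∀ u, ∑ v, M u v * x u * x v ≤ ∑ v, (g u v * x u ^ 2 + g v u * x v ^ 2) :=
    fun u => Finset.sum_le_sum fun v _ => hg u v
  have l1 : ∑ u, ∑ v, M u v * x u * x v ≤ ∑ u, ∑ v, (g u v * x u ^ 2 + g v u * x v ^ 2) :=
    Finset.sum_le_sum fun u _ => l0 u
  have l2' : ∀ u, 2 * ((∑ v, g u v) * x u ^ 2) ≤ 2 * (θ * x u ^ 2) := fun u =>
    mul_le_mul_of_nonneg_left (mul_le_mul_of_nonneg_right (hs u) (sq_nonneg _)) zero_le_two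
  have l2 : ∑ u, 2 * ((∑ v, g u v) * x u ^ 2) ≤ ∑ u, 2 * (θ * x u ^ 2) :=
    Finset.sum_le_sum fun u _ => l2' u
  refine ⟨by rw [e1, e3]; exact (l1.trans e2.le).trans l2, fun hge => ?_⟩
  rw [e1, e3] at hge
  have t1 : ∑ u, ∑ v, M u v * x u * x v = ∑ u, ∑ v, (g u v * x u ^ 2 + g v u * x v ^ 2) := by
    linarith
  have t2 : ∑ u, 2 * ((∑ v, g u v) * x u ^ 2) = ∑ u, 2 * (θ * x u ^ 2) := by linarith
  rw [Finset.sum_eq_sum_iff_of_le fun u _ => l0 u] at t1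
  rw [Finset.sum_eq_sum_iff_of_le fun u _ => l2' u] at t2
  refine ⟨fun u v => ?_, fun u hu => ?_⟩
  · exact (Finset.sum_eq_sum_iff_of_le fun v _ => hg u v).1 (t1 u (Finset.mem_univ u)) v
      (Finset.mem_univ v)
  · have := t2 u (Finset.mem_univ u)
    have hu2 : x u ^ 2 ≠ 0 := pow_ne_zero 2 hu
    exact mul_right_cancel₀ hu2 (mul_left_cancel₀ two_ne_zero this)

open Matrix in
/-- Weights on the edges that bound the quadratic form of `M` on a hyperplane bound the second
largest eigenvalue of `M`; in case of equality they are tight at an eigenvector. -/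
theorem eigenvector_of_weights [DecidableEq V] {M : Matrix V V ℝ} (hM : M.IsHermitian)
    (h : 1 < Fintype.card V) (ψ : (V → ℝ) →ₗ[ℝ] ℝ) {g : V → V → ℝ} {θ : ℝ}
    (hg : ∀ x, ψ x = 0 → ∀ u v, M u v * x u * x v ≤ g u v * x u ^ 2 + g v u * x v ^ 2)
    (hs : ∀ u, ∑ v, g u v ≤ θ) (hθ : 2 * θ ≤ hM.eigenvalues₀ ⟨1, h⟩) :
    hM.eigenvalues₀ ⟨1, h⟩ = 2 * θ ∧ ∃ x, x ≠ 0 ∧ ψ x = 0 ∧ M *ᵥ x = (2 * θ) • x ∧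
      (∀ u v, M u v * x u * x v = g u v * x u ^ 2 + g v u * x v ^ 2) ∧
        ∀ u, x u ≠ 0 → ∑ v, g u v = θ := by
  obtain ⟨he, x, hx, hψ, hMx⟩ := eigenvector_of_form_le_on_hyperplane hM h ψ
    (fun x hx => (form_le_sum_weights (hg x hx) hs).1) hθ
  refine ⟨he, x, hx, hψ, hMx, (form_le_sum_weights (hg x hψ) hs).2 ?_⟩
  rw [hMx, dotProduct_smul, smul_eq_mul]

end Weights

/-! ### Reciprocal weights on a rooted tree -/

namespace SimpleGraph

section RootedWeight

variable {V : Type*} {T : SimpleGraph V}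

open Classical in
/-- The reciprocal weights on the darts of a tree rooted at `r` that are given by `h` on the darts
that lead away from the root. -/
noncomputable def rootedWeight (T : SimpleGraph V) (r : V) (h : V → V → ℝ) (u v : V) : ℝ :=
  if T.Adj u v then if T.dist r u < T.dist r v then h u v else (h v u)⁻¹ else 0

theorem rootedWeight_of_not_adj {r u v : V} (h : V → V → ℝ) (huv : ¬ T.Adj u v) :
    T.rootedWeight r h u v = 0 := if_neg huv

theorem rootedWeight_of_lt {r u v : V} (h : V → V → ℝ) (huv : T.Adj u v)
    (hlt : T.dist r u < T.dist r v) : T.rootedWeight r h u v = h u v := by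
  rw [rootedWeight, if_pos huv, if_pos hlt]

theorem rootedWeight_of_gt {r u v : V} (h : V → V → ℝ) (huv : T.Adj u v)
    (hlt : T.dist r u < T.dist r v) : T.rootedWeight r h v u = (h u v)⁻¹ := by
  rw [rootedWeight, if_pos huv.symm, if_neg hlt.not_gt]

theorem IsTree.dist_lt_of_adj (hT : T.IsTree) {r p v w : V} (hpv : T.Adj p v)
    (hlt : T.dist r p < T.dist r v) (hvw : T.Adj v w) (hw : w ≠ p) :
    T.dist r v < T.dist r w := by
  by_contra h
  have := hT.dist_ne_of_adj r hvw
  exact hw (hT.eq_of_adj_of_dist_lt hvw hpv.symm (by omega) hlt)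

theorem dist_root_lt {r c : V} (h : T.Adj r c) : T.dist r r < T.dist r c := by
  rw [dist_self, dist_eq_one_iff_adj.2 h]; exact one_pos

/-- Case distinction for the pairs of vertices of a rooted tree. -/
theorem IsTree.adj_cases (hT : T.IsTree) (r : V) {P : V → V → Prop}
    (hsymm : ∀ u v, P u v → P v u) (h0 : ∀ u v, ¬ T.Adj u v → P u v)
    (h1 : ∀ u v, T.Adj u v → T.dist r u < T.dist r v → P u v) (u v : V) : P u v := by
  by_cases h : T.Adj u v
  · rcases lt_or_gt_of_ne (hT.dist_ne_of_adj r h) with hlt | hlt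
    · exact h1 u v h hlt
    · exact hsymm _ _ (h1 v u h.symm hlt)
  · exact h0 u v h

variable [Fintype V]

open Classical in
theorem sum_rootedWeight_root (r : V) (h : V → V → ℝ) :
    ∑ v, T.rootedWeight r h r v = ∑ v, if T.Adj r v then h r v else 0 := by
  refine Finset.sum_congr rfl fun v _ => ?_
  split_ifs with hv
  · exact rootedWeight_of_lt h hv (dist_root_lt hv)
  · exact rootedWeight_of_not_adj h hv

open Classical in
theorem IsTree.sum_rootedWeight [DecidableEq V]
    (hT : T.IsTree) {r p v : V} (h : V → V → ℝ) (hpv : T.Adj p v)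
    (hlt : T.dist r p < T.dist r v) :
    ∑ w, T.rootedWeight r h v w =
      (h p v)⁻¹ + ∑ w ∈ Finset.univ.erase p, if T.Adj v w then h v w else 0 := by
  rw [← Finset.add_sum_erase _ _ (Finset.mem_univ p), rootedWeight_of_gt h hpv hlt]
  congr 1
  refine Finset.sum_congr rfl fun w hw => ?_
  split_ifs with hvw
  · exact rootedWeight_of_lt h hvw (hT.dist_lt_of_adj hpv hlt hvw (Finset.ne_of_mem_erase hw))
  · exact rootedWeight_of_not_adj h hvw

open Classical in
-- The branches at `v` away from `p` have `T.branchCard p v - 1` vertices in total, so weights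
-- proportional to branch sizes have an explicit sum.
theorem IsTree.sum_weight_erase_le [DecidableEq V]
    (hT : T.IsTree) {p v : V} {h : V → V → ℝ} {a : ℝ}
    (hpv : T.Adj p v) (hh : ∀ w, w ≠ p → T.Adj v w → h v w ≤ T.branchCard v w * a) :
    (∑ w ∈ Finset.univ.erase p, if T.Adj v w then h v w else 0) ≤
      ((T.branchCard p v : ℝ) - 1) * a := by
  have h1 : ((T.branchCard p v : ℝ) - 1) = ∑ w ∈ Finset.univ.erase p, (T.branchCard v w : ℝ) := by
    rw [← hT.sum_branchCard_erase hpv]; push_cast; ring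
  rw [h1, Finset.sum_mul]
  refine Finset.sum_le_sum fun w hw => ?_
  split_ifs with hvw
  · exact hh w (Finset.ne_of_mem_erase hw) hvw
  · rw [branchCard_of_not_adj hvw]; simp

open Classical in
theorem IsTree.sum_weight_erase_eq [DecidableEq V]
    (hT : T.IsTree) {p v : V} {h : V → V → ℝ} {a : ℝ}
    (hpv : T.Adj p v) (hh : ∀ w, w ≠ p → T.Adj v w → h v w = T.branchCard v w * a) :
    (∑ w ∈ Finset.univ.erase p, if T.Adj v w then h v w else 0) =
      ((T.branchCard p v : ℝ) - 1) * a := by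
  have h1 : ((T.branchCard p v : ℝ) - 1) = ∑ w ∈ Finset.univ.erase p, (T.branchCard v w : ℝ) := by
    rw [← hT.sum_branchCard_erase hpv]; push_cast; ring
  rw [h1, Finset.sum_mul]
  refine Finset.sum_congr rfl fun w hw => ?_
  split_ifs with hvw
  · exact hh w (Finset.ne_of_mem_erase hw) hvw
  · rw [branchCard_of_not_adj hvw]; simp

/-- Branches away from the root are smaller than a branch at the root that contains them. -/
theorem IsTree.exists_branchCard_le (hT : T.IsTree) {r : V} : ∀ {p v : V}, T.Adj p v →
    T.dist r p < T.dist r v → p ≠ r →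
    ∃ c, T.Adj r c ∧ T.branchCard p v + 1 ≤ T.branchCard r c := by
  suffices H : ∀ k, ∀ {p v : V}, T.dist r p = k → T.Adj p v →
      T.dist r p < T.dist r v → p ≠ r →
      ∃ c, T.Adj r c ∧ T.branchCard p v + 1 ≤ T.branchCard r c from
    fun {p v} h1 h2 h3 => H _ rfl h1 h2 h3
  intro k
  induction k using Nat.strong_induction_on with
  | _ k ih =>
    intro p v hk hpv hlt hpr
    obtain ⟨q, hpq, hq⟩ := hT.connected.exists_adj_dist_lt (Ne.symm hpr)
    have hvq : v ≠ q := by rintro rfl; omega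
    have h1 := hT.branchCard_lt hpq.symm hvq
    by_cases hqr : q = r
    · subst hqr; exact ⟨p, hpq.symm, h1⟩
    · obtain ⟨c, hc, h2⟩ := ih _ (hk ▸ hq) rfl hpq.symm hq hqr
      exact ⟨c, hc, by omega⟩

end RootedWeight

end SimpleGraph

/-- The difference of the two sides is `h⁻¹ (h a - b)²`; in the equality case `b = h a`, so zeros
propagate along edges. -/
theorem two_mul_le_weights {h : ℝ} (hh : 0 < h) (a b : ℝ) :
    2 * a * b ≤ h * a ^ 2 + h⁻¹ * b ^ 2 := by
  have : h * a ^ 2 + h⁻¹ * b ^ 2 - 2 * a * b = h⁻¹ * (h * a - b) ^ 2 := by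
    field_simp; ring
  have h2 : 0 ≤ h⁻¹ * (h * a - b) ^ 2 := by positivity
  linarith

theorem eq_zero_iff_of_two_mul_eq_weights {h : ℝ} (hh : 0 < h) {a b : ℝ}
    (hab : 2 * a * b = h * a ^ 2 + h⁻¹ * b ^ 2) : a = 0 ↔ b = 0 := by
  have h1 : h⁻¹ * (h * a - b) ^ 2 = 0 := by
    have : h * a ^ 2 + h⁻¹ * b ^ 2 - 2 * a * b = h⁻¹ * (h * a - b) ^ 2 := by
      field_simp; ring
    linarith
  have h2 : h * a = b := by
    have := (mul_eq_zero.1 h1).resolve_left (inv_pos.2 hh).ne'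
    linarith [pow_eq_zero_iff two_ne_zero |>.1 this]
  rw [← h2, mul_eq_zero]
  simp [hh.ne']

open SimpleGraph

/-! ### The bound from a vertex with small branches -/

section Centroid

variable {V : Type*} [Fintype V] [DecidableEq V] {T : SimpleGraph V}

/-- The second largest eigenvalue is at most `2 * θ` if all branches at some vertex have at most
`θ ^ 2 + 1` vertices; in case of equality there is an eigenvector that vanishes at this vertex, and
the branches at the vertices where it does not vanish have one of the extremal sizes. -/
theorem xiTwo_compl_of_branchCard_le (hT : T.IsTree) (hTc : Tᶜ.Connected) (h1 : 1 < Fintype.card V)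
    {r : V} {θ : ℝ} (hθ : 0 < θ) (hleaf : ∀ c, T.branchCard r c + 1 ≠ Fintype.card V)
    (hK : ∀ c, (T.branchCard r c : ℝ) ≤ θ ^ 2 + 1) (hge : 2 * θ ≤ xiTwo Tᶜ h1) :
    xiTwo Tᶜ h1 = 2 * θ ∧ ∃ x : V → ℝ, x ≠ 0 ∧ x r = 0 ∧ (eccMatrix Tᶜ).mulVec x = (2 * θ) • x ∧
      (∀ u v, T.Adj u v → u ≠ r → v ≠ r → x u = 0 → x v = 0) ∧
      (∀ c, T.Adj r c → x c ≠ 0 → (T.branchCard r c : ℝ) = θ ^ 2 + 1) ∧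
      (∀ p v, T.Adj p v → T.dist r p < T.dist r v → p ≠ r → x v ≠ 0 →
        T.branchCard p v = 1 ∨ (T.branchCard p v : ℝ) = θ ^ 2) := by
  have : Nontrivial V := Fintype.one_lt_card_iff_nontrivial.1 h1
  -- Edges at the root contribute nothing when `x r = 0`, so they get weight 0 in both directions;
  -- the convention `0⁻¹ = 0` supplies the reverse one.
  set h : V → V → ℝ := fun p v => if p = r then 0 else T.branchCard p v * θ⁻¹ with hh
  -- A dominating edge avoiding `r` would make `r` a leaf, which `hleaf` excludes.
  have hE : ∀ {u v}, T.Adj u v → u ≠ r → v ≠ r → eccMatrix Tᶜ u v = 2 := fun {u v} huv hu hv => by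
    refine eccMatrix_compl_of_not_isDominatingEdge hT hTc huv fun hd => ?_
    obtain ⟨c, hc⟩ := hT.exists_branchCard_of_isDominatingEdge hd hu.symm hv.symm
    exact hleaf c hc
  have hhr : ∀ v, h r v = 0 := fun v => if_pos rfl
  have hhp : ∀ {p v}, p ≠ r → h p v = T.branchCard p v * θ⁻¹ := fun hp => if_neg hp
  have hpos : ∀ {p v}, p ≠ r → T.Adj p v → 0 < h p v := fun hp hpv => by
    rw [hhp hp]
    have := branchCard_pos hpv
    positivity
  have hne : ∀ {p v}, T.dist r p < T.dist r v → v ≠ r := fun hlt => by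
    rintro rfl; simp at hlt
  have hchild : ∀ {p v}, T.Adj p v → T.dist r p < T.dist r v →
      ∑ w, T.rootedWeight r h v w = (h p v)⁻¹ + ((T.branchCard p v : ℝ) - 1) * θ⁻¹ := by
    intro p v hpv hlt
    rw [hT.sum_rootedWeight h hpv hlt, hT.sum_weight_erase_eq hpv]
    exact fun w _ _ => hhp (hne hlt)
  have hbound : ∀ {p v}, T.Adj p v → T.dist r p < T.dist r v → p ≠ r →
      (T.branchCard p v : ℝ) ≤ θ ^ 2 := by
    intro p v hpv hlt hpr
    obtain ⟨c, -, hc⟩ := hT.exists_branchCard_le hpv hlt hpr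
    have h2 : (T.branchCard p v : ℝ) + 1 ≤ T.branchCard r c := by exact_mod_cast hc
    linarith [hK c]
  -- The slack at a vertex below the first level, in factored form: nonnegative for branch sizes
  -- from 1 to `θ ^ 2`, and zero exactly at the two ends. The zeros give the dichotomy in the
  -- equality case.
  have hdeep : ∀ {p v}, T.Adj p v → p ≠ r →
      θ - ((h p v)⁻¹ + ((T.branchCard p v : ℝ) - 1) * θ⁻¹) =
        (T.branchCard p v - 1) * (θ ^ 2 - T.branchCard p v) / (θ * T.branchCard p v) := by
    intro p v hpv hp
    have : (0 : ℝ) < T.branchCard p v := by exact_mod_cast branchCard_pos hpv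
    rw [hhp hp]
    field_simp
    ring
  have hedge : ∀ x : V → ℝ, (LinearMap.proj r : (V → ℝ) →ₗ[ℝ] ℝ) x = 0 → ∀ u v,
      eccMatrix Tᶜ u v * x u * x v ≤
        T.rootedWeight r h u v * x u ^ 2 + T.rootedWeight r h v u * x v ^ 2 := by
    intro x hx
    have hx : x r = 0 := hx
    refine hT.adj_cases r (fun u v H => ?_) (fun u v huv => ?_) (fun u v huv hlt => ?_)
    · have h2 : eccMatrix Tᶜ v u = eccMatrix Tᶜ u v := (eccMatrix_isHermitian Tᶜ).apply u v
      rw [h2]; linarith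
    · rw [eccMatrix_compl_of_not_adj hT huv, rootedWeight_of_not_adj h huv,
        rootedWeight_of_not_adj h fun h' => huv h'.symm]
      simp
    · rw [rootedWeight_of_lt h huv hlt, rootedWeight_of_gt h huv hlt]
      by_cases hu : u = r
      · subst hu; simp [hx, hhr]
      · rw [hE huv hu (hne hlt)]
        exact two_mul_le_weights (hpos hu huv) _ _
  have hvert : ∀ v, ∑ w, T.rootedWeight r h v w ≤ θ := by
    intro v
    by_cases hv : v = r
    · subst hv
      rw [sum_rootedWeight_root]
      simp [hhr, hθ.le]
    · obtain ⟨p, hvp, hlt⟩ := hT.connected.exists_adj_dist_lt (Ne.symm hv)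
      rw [hchild hvp.symm hlt]
      by_cases hp : p = r
      · subst hp
        rw [hhr, inv_zero, zero_add, ← div_eq_mul_inv, div_le_iff₀ hθ]
        linarith [hK v]
      · rw [← sub_nonneg, hdeep hvp.symm hp]
        have h2 : (1 : ℝ) ≤ T.branchCard p v := by exact_mod_cast branchCard_pos hvp.symm
        have h3 := hbound hvp.symm hlt hp
        exact div_nonneg (mul_nonneg (by linarith) (by linarith)) (by positivity)
  obtain ⟨he, x, hx, hxr, hMx, ht, hs⟩ := eigenvector_of_weights (eccMatrix_isHermitian Tᶜ) h1
    (LinearMap.proj r) (g := T.rootedWeight r h) (θ := θ) hedge hvert hge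
  refine ⟨he, x, hx, hxr, hMx, ?_, ?_, ?_⟩
  · suffices H : ∀ u v, T.Adj u v → u ≠ r → v ≠ r → (x u = 0 ↔ x v = 0) from
      fun u v h1 h2 h3 => (H u v h1 h2 h3).1
    refine hT.adj_cases r (fun u v H h1 h2 h3 => (H h1.symm h3 h2).symm)
      (fun u v h1 h2 => absurd h2 h1) fun u v huv hlt _ hu hv => ?_
    have := ht u v
    rw [hE huv hu hv, rootedWeight_of_lt h huv hlt, rootedWeight_of_gt h huv hlt] at this
    exact eq_zero_iff_of_two_mul_eq_weights (hpos hu huv) this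
  · intro c hc hxc
    have := hs c hxc
    rw [hchild hc (dist_root_lt hc), hhr, inv_zero, zero_add, ← div_eq_mul_inv,
      div_eq_iff hθ.ne'] at this
    linarith
  · intro p v hpv hlt hp hxv
    have h2 := hs v hxv
    have h3 := hdeep hpv hp
    have : (0 : ℝ) < T.branchCard p v := by exact_mod_cast branchCard_pos hpv
    rw [← hchild hpv hlt, h2, sub_self, eq_comm, div_eq_zero_iff] at h3
    rcases h3.resolve_right (by positivity) |> mul_eq_zero.1 with h4 | h4
    · left; exact_mod_cast sub_eq_zero.1 h4
    · right; linarith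

end Centroid

/-! ### Trees halved by an edge -/

/-- After clearing denominators this is `(k - 1)(t² - k) ≥ 0`. The left side is the weight that
makes the sum at a vertex exactly `t` when its children carry weights `k' / t`; it improves on `k /
t` for `1 < k < t²`. -/
theorem inv_weight_le {t k : ℝ} (ht : 0 < t) (hk : k ≤ t ^ 2) (hk1 : 1 ≤ k) :
    t / (t ^ 2 - k + 1) ≤ k * t⁻¹ := by
  rw [← div_eq_mul_inv, div_le_div_iff₀ (by linarith) ht]
  nlinarith [mul_nonneg (sub_nonneg.2 hk1) (sub_nonneg.2 hk)]

/-- The gain from a branch with `k ≥ 2` vertices below a branch with `m - 1` vertices. -/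
theorem balanced_weight_gain {t k m : ℝ} (ht : 0 < t) (ht2 : t ^ 2 = m - 3 / 2) (hk : 2 ≤ k)
    (hkm : k ≤ m - 2) :
    ((m - 1) * t⁻¹)⁻¹ + ((m - 2) * t⁻¹ - (k * t⁻¹ - t / (t ^ 2 - k + 1))) ≤ t := by
  -- With `k = a + 2` and `m = a + j + 4` the slack becomes a quotient of polynomials with
  -- nonnegative coefficients (up to the factor `t`), so `positivity` applies.
  obtain ⟨a, rfl⟩ : ∃ a, k = a + 2 := ⟨k - 2, by ring⟩
  obtain ⟨j, rfl⟩ : ∃ j, m = a + j + 4 := ⟨m - a - 4, by ring⟩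
  have ha : 0 ≤ a := by linarith
  have hj : 0 ≤ j := by linarith
  have hd : t ^ 2 - (a + 2) + 1 = j + 3 / 2 := by rw [ht2]; ring
  have key : t - (((a + j + 4 - 1) * t⁻¹)⁻¹ + ((a + j + 4 - 2) * t⁻¹ -
      ((a + 2) * t⁻¹ - t / (t ^ 2 - (a + 2) + 1)))) =
      (2 * a ^ 2 * j + a ^ 2 + 2 * a * j ^ 2 + 8 * a * j + 5 / 2 * a + j ^ 2 + 7 / 2 * j) /
        (2 * t * (a + j + 3) * (j + 3 / 2)) := by
    rw [hd]
    have h1 : a + j + 3 ≠ 0 := by positivity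
    have h2 : j + 3 / 2 ≠ 0 := by positivity
    have h3 : a + j + 4 - 1 = a + j + 3 := by ring
    rw [h3, eq_div_iff (by positivity)]
    field_simp
    have h4 : t ^ 2 = a + j + 5 / 2 := by rw [ht2]; ring
    rw [h4]
    ring
  rw [← sub_nonneg, key]
  positivity

theorem balanced_weight_le {t k m : ℝ} (ht : 0 < t) (ht2 : t ^ 2 = m - 3 / 2) (hk : 1 ≤ k)
    (hkm : k ≤ m - 1) : (k * (2 * t / (m - 1)))⁻¹ + (k - 1) * t⁻¹ ≤ t := by
  have hm : 0 < m - 1 := by linarith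
  have key : t - ((k * (2 * t / (m - 1)))⁻¹ + (k - 1) * t⁻¹) =
      (2 * k - 1) * (m - 1 - k) / (2 * t * k) := by
    field_simp
    rw [ht2]; ring
  rw [← sub_nonneg, key]
  exact div_nonneg (mul_nonneg (by linarith) (by linarith)) (by positivity)

section Balanced

variable {V : Type*} [Fintype V] [DecidableEq V] {T : SimpleGraph V}

/-- A tree with an edge `u w` that halves the tree, such that the half of `u` is not a star with
leaf `u`, has small second largest eigenvalue. -/
theorem xiTwo_compl_lt_of_balanced_edge (hT : T.IsTree) (hTc : Tᶜ.Connected)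
    (h1 : 1 < Fintype.card V) {m : ℕ} (hm : 2 ≤ m) (hcard : Fintype.card V = 2 * m) {u w : V}
    (huw : T.Adj u w) (hKuw : T.branchCard u w = m)
    (hstar : ∀ c, T.Adj u c → c ≠ w → T.branchCard u c + 1 = m → 2 ≤ T.branchCard u c →
      ∃ e, T.Adj c e ∧ e ≠ u ∧ 2 ≤ T.branchCard c e) :
    xiTwo Tᶜ h1 < 2 * √((m : ℝ) - 3 / 2) := by
  have : Nontrivial V := Fintype.one_lt_card_iff_nontrivial.1 h1
  classical
  have hmR : (2 : ℝ) ≤ m := by exact_mod_cast hm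
  set t : ℝ := √((m : ℝ) - 3 / 2) with ht
  have htpos : 0 < t := Real.sqrt_pos.2 (by linarith)
  have ht2 : t ^ 2 = m - 3 / 2 := Real.sq_sqrt (by linarith)
  -- The tree is rooted at `u`. The edge `uw` gets the negative weights `-t⁻¹` and `-t`. The factor
  -- `2 * t / (m - 1)` distributes `2t` over the `m - 1` vertices below `w`, so the sum at `w` is
  -- exactly `-t + 2t = t`.
  set h : V → V → ℝ := fun p v =>
    if p = u then if v = w then -t⁻¹ else T.branchCard p v * t⁻¹
    else if p = w then T.branchCard p v * (2 * t / (m - 1))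
    else t / (t ^ 2 - T.branchCard p v + 1) with hh
  have huw' : w ≠ u := huw.ne'
  have hK0 : ∀ {c}, c ≠ w → T.branchCard u c + 1 ≤ m := fun {c} hc => by
    have := hT.branchCard_add_le (u := u) hc
    omega
  have hKu : ∀ c, T.branchCard u c ≤ m := fun c => by
    by_cases hc : c = w
    · rw [hc, hKuw]
    · have := hK0 hc; omega
  have hKw : ∀ c, T.branchCard w c ≤ m := fun c => by
    by_cases hc : c = u
    · have := hT.branchCard_add huw
      rw [hc]; omega
    · have := hT.branchCard_lt huw hc; omega
  have hK1 : ∀ {p v}, T.Adj p v → T.dist u p < T.dist u v → p ≠ u → T.branchCard p v + 1 ≤ m := by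
    intro p v hpv hlt hp
    obtain ⟨c, -, hc⟩ := hT.exists_branchCard_le hpv hlt hp
    exact hc.trans (hKu c)
  have hK2 : ∀ {p v}, T.Adj p v → T.dist u p < T.dist u v → p ≠ u → p ≠ w →
      T.branchCard p v + 2 ≤ m := by
    intro p v hpv hlt hp hpw
    obtain ⟨q, hpq, hq⟩ := hT.connected.exists_adj_dist_lt (Ne.symm hp)
    have hvq : v ≠ q := by rintro rfl; omega
    have h1 := hT.branchCard_lt hpq.symm hvq
    by_cases hqu : q = u
    · subst hqu
      have := hK0 hpw; omega
    · have := hK1 hpq.symm hq hqu; omega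
  have hE : ∀ {a b}, T.Adj a b → ¬ (a = u ∧ b = w) → ¬ (a = w ∧ b = u) →
      eccMatrix Tᶜ a b = 2 := fun {a b} hab h2 h3 => by
    refine eccMatrix_compl_of_not_isDominatingEdge hT hTc hab fun hd => ?_
    by_cases hu : u ≠ a ∧ u ≠ b
    · obtain ⟨c, hc⟩ := hT.exists_branchCard_of_isDominatingEdge hd hu.1 hu.2
      have := hKu c; omega
    · have hw : w ≠ a ∧ w ≠ b := by
        constructor <;> rintro rfl <;> grind
      obtain ⟨c, hc⟩ := hT.exists_branchCard_of_isDominatingEdge hd hw.1 hw.2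
      have := hKw c; omega
  have hne : ∀ {p v}, T.dist u p < T.dist u v → v ≠ u := fun hlt => by
    rintro rfl; simp at hlt
  have huwt : h u w = -t⁻¹ := by simp [hh]
  have hu : ∀ {v}, v ≠ w → h u v = T.branchCard u v * t⁻¹ := fun hv => by simp [hh, hv]
  have hw : ∀ {v}, h w v = T.branchCard w v * (2 * t / (m - 1)) := by simp [hh, huw']
  have hp' : ∀ {p v}, p ≠ u → p ≠ w → h p v = t / (t ^ 2 - T.branchCard p v + 1) :=
    fun h1 h2 => by simp [hh, h1, h2]
  have hKpos : ∀ {p v}, T.Adj p v → (1 : ℝ) ≤ T.branchCard p v := fun hpv => by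
    exact_mod_cast branchCard_pos hpv
  have hpos : ∀ {p v}, T.Adj p v → T.dist u p < T.dist u v → ¬ (p = u ∧ v = w) → 0 < h p v := by
    intro p v hpv hlt hnot
    have h2 := hKpos hpv
    by_cases hpu : p = u
    · subst hpu
      rw [hu fun h => hnot ⟨rfl, h⟩]
      positivity
    · by_cases hpw : p = w
      · subst hpw
        have : (0 : ℝ) < m - 1 := by linarith
        rw [hw]
        positivity
      · rw [hp' hpu hpw]
        have h3 : (T.branchCard p v : ℝ) + 2 ≤ m := by exact_mod_cast hK2 hpv hlt hpu hpw
        exact div_pos htpos (by rw [ht2]; linarith)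
  have hle : ∀ {p v}, T.Adj p v → T.dist u p < T.dist u v → p ≠ u → p ≠ w →
      h p v ≤ T.branchCard p v * t⁻¹ := by
    intro p v hpv hlt hpu hpw
    have h3 : (T.branchCard p v : ℝ) + 2 ≤ m := by exact_mod_cast hK2 hpv hlt hpu hpw
    rw [hp' hpu hpw]
    exact inv_weight_le htpos (by rw [ht2]; linarith) (hKpos hpv)
  -- On `x u = -t x w` the negative weights reproduce `2 x u x w` exactly. Since this product is
  -- nonpositive, a larger entry on a dominating edge `uw` does no harm.
  set ψ : (V → ℝ) →ₗ[ℝ] ℝ := t • LinearMap.proj w + LinearMap.proj u with hψ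
  have hψx : ∀ x : V → ℝ, ψ x = 0 → x u = -(t * x w) := fun x hx => by
    have : t * x w + x u = 0 := hx
    linarith
  have hedge : ∀ x : V → ℝ, ψ x = 0 → ∀ a b, eccMatrix Tᶜ a b * x a * x b ≤
      T.rootedWeight u h a b * x a ^ 2 + T.rootedWeight u h b a * x b ^ 2 := by
    intro x hx
    refine hT.adj_cases u (fun a b H => ?_) (fun a b hab => ?_) (fun a b hab hlt => ?_)
    · have h2 : eccMatrix Tᶜ b a = eccMatrix Tᶜ a b := (eccMatrix_isHermitian Tᶜ).apply a b
      rw [h2]; linarith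
    · rw [eccMatrix_compl_of_not_adj hT hab, rootedWeight_of_not_adj h hab,
        rootedWeight_of_not_adj h fun h' => hab h'.symm]
      simp
    · rw [rootedWeight_of_lt h hab hlt, rootedWeight_of_gt h hab hlt]
      by_cases hab' : a = u ∧ b = w
      · obtain ⟨rfl, rfl⟩ := hab'
        rw [huwt, hψx x hx, inv_neg, inv_inv]
        have h2 := two_le_eccMatrix_compl hT hTc hab
        have h3 : -t⁻¹ * (-(t * x b)) ^ 2 + -t * x b ^ 2 = -(2 * (t * x b ^ 2)) := by
          field_simp; ring
        have h4 : 0 ≤ t * x b ^ 2 := by positivity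
        rw [h3]
        nlinarith
      · rw [hE hab hab' fun h2 => hne hlt h2.2]
        exact two_mul_le_weights (hpos hab hlt hab') _ _
  -- The sum is `(m - 2) / t`, strictly below `t` because `t² = m - 3/2`. This strictness later
  -- forces `x u = 0` in a hypothetical equality case.
  have hroot : ∑ v, T.rootedWeight u h u v < t := by
    rw [sum_rootedWeight_root, ← Finset.add_sum_erase _ _ (Finset.mem_univ w),
      hT.sum_weight_erase_eq huw.symm (fun v hv _ => hu hv), if_pos huw, huwt]
    have h2 : T.branchCard w u = m := by have := hT.branchCard_add huw; omega
    rw [h2]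
    have h3 : -t⁻¹ + ((m : ℝ) - 1) * t⁻¹ = (m - 2) / t := by field_simp; ring
    rw [h3, div_lt_iff₀ htpos, ← sq, ht2]
    linarith
  have hvert : ∀ v, ∑ b, T.rootedWeight u h v b ≤ t := by
    intro v
    by_cases hv : v = u
    · rw [hv]; exact hroot.le
    obtain ⟨p, hvp, hlt⟩ := hT.connected.exists_adj_dist_lt (Ne.symm hv)
    have hpv := hvp.symm
    rw [hT.sum_rootedWeight h hpv hlt]
    have h2 := hKpos hpv
    by_cases hvw : v = w
    · subst hvw
      have hpu : p = u := by
        by_contra hp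
        have := hT.dist_lt_of_adj huw (dist_root_lt huw) hvp hp
        omega
      subst hpu
      rw [hT.sum_weight_erase_eq hpv (fun v hv _ => hw), huwt, inv_neg, inv_inv, hKuw]
      have : (m : ℝ) - 1 ≠ 0 := by linarith
      field_simp
      linarith
    have hch : ∀ {b}, b ≠ p → T.Adj v b → T.dist u v < T.dist u b := fun hb hvb =>
      hT.dist_lt_of_adj hpv hlt hvb hb
    have hsum := hT.sum_weight_erase_le hpv (fun b hb hvb => hle hvb (hch hb hvb) hv hvw)
    by_cases hpu : p = u
    · subst hpu
      have h3 : (T.branchCard p v : ℝ) + 1 ≤ m := by exact_mod_cast hK0 hvw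
      rw [hu hvw]
      have hgen : ((T.branchCard p v : ℝ) - 1) * (t ^ 2 - T.branchCard p v) ≥ 0 →
          (T.branchCard p v * t⁻¹)⁻¹ + ((T.branchCard p v : ℝ) - 1) * t⁻¹ ≤ t := fun hge => by
        have : t - ((T.branchCard p v * t⁻¹)⁻¹ + ((T.branchCard p v : ℝ) - 1) * t⁻¹) =
            ((T.branchCard p v : ℝ) - 1) * (t ^ 2 - T.branchCard p v) / (t * T.branchCard p v) := by
          field_simp; ring
        rw [← sub_nonneg, this]
        positivity
      -- The slack `(K - 1)(t² - K)` is negative only for `K = m - 1 ≥ 2`. Then `hstar` gives a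
      -- nonleaf branch below `v`, whose weight undercuts `k / t` by enough to compensate.
      by_cases hbig : T.branchCard p v + 1 = m ∧ 2 ≤ T.branchCard p v
      · obtain ⟨e, hve, hep, he2⟩ := hstar v hpv hvw hbig.1 hbig.2
        have hKe : (T.branchCard v e : ℝ) + 2 ≤ m := by
          exact_mod_cast hK2 hve (hch hep hve) hv hvw
        have hKm : (T.branchCard p v : ℝ) = m - 1 := by
          rw [← hbig.1]; push_cast; ring
        refine le_trans ?_ (balanced_weight_gain htpos ht2 (k := T.branchCard v e)
          (by exact_mod_cast he2) (by linarith))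
        rw [hKm]
        refine add_le_add_right ?_ _
        have hmem : e ∈ Finset.univ.erase p := Finset.mem_erase.2 ⟨hep, Finset.mem_univ e⟩
        have h4 : ((m : ℝ) - 2) * t⁻¹ =
            ∑ b ∈ Finset.univ.erase p, (T.branchCard v b : ℝ) * t⁻¹ := by
          rw [← Finset.sum_mul]
          have h5 := hT.sum_branchCard_erase hpv
          have h6 : ((∑ b ∈ Finset.univ.erase p, T.branchCard v b : ℕ) : ℝ) + 1 = m - 1 := by
            rw [← hKm, ← h5]; push_cast; ring
          push_cast at h6
          congr 1; linarith
        rw [h4, ← Finset.add_sum_erase _ _ hmem, ← Finset.add_sum_erase _ _ hmem, if_pos hve,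
          hp' hv hvw]
        have h7 : (∑ b ∈ (Finset.univ.erase p).erase e, if T.Adj v b then h v b else 0) ≤
            ∑ b ∈ (Finset.univ.erase p).erase e, (T.branchCard v b : ℝ) * t⁻¹ := by
          refine Finset.sum_le_sum fun b hb => ?_
          split_ifs with hvb
          · exact hle hvb (hch (Finset.ne_of_mem_erase (Finset.mem_of_mem_erase hb)) hvb) hv hvw
          · rw [branchCard_of_not_adj hvb]; simp
        linarith
      · refine (add_le_add_right hsum _).trans (hgen ?_)
        rcases Nat.lt_or_ge (T.branchCard p v) 2 with hlt2 | hge2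
        · have h5 : T.branchCard p v = 1 := by
            have := branchCard_pos hpv; omega
          rw [h5]; simp
        · have h5 : T.branchCard p v + 2 ≤ m := by
            have := hK0 (c := v) hvw; omega
          have h6 : (T.branchCard p v : ℝ) + 2 ≤ m := by exact_mod_cast h5
          exact mul_nonneg (by linarith) (by rw [ht2]; linarith)
    · have h3 : (T.branchCard p v : ℝ) + 1 ≤ m := by exact_mod_cast hK1 hpv hlt hpu
      refine (add_le_add_right hsum _).trans ?_
      by_cases hpw : p = w
      · subst hpw
        rw [hw]
        exact balanced_weight_le htpos ht2 h2 (by linarith)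
      · rw [hp' hpu hpw, inv_div]
        have h4 : (t ^ 2 - T.branchCard p v + 1) / t + ((T.branchCard p v : ℝ) - 1) * t⁻¹ = t := by
          field_simp; ring
        exact h4.le
  -- At a tight eigenvector `x u = 0`, so `x w = 0` on the hyperplane, and zeros spread along all
  -- other edges: the eigenvector would vanish.
  by_contra hge
  obtain ⟨-, x, hx, hxψ, -, htight, hs⟩ := eigenvector_of_weights (eccMatrix_isHermitian Tᶜ) h1
    ψ hedge hvert (not_lt.1 hge)
  have hxu : x u = 0 := by
    by_contra hxu
    exact hroot.ne (hs u hxu)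
  have hxw : x w = 0 := by
    have := hψx x hxψ
    rw [hxu] at this
    exact (mul_eq_zero.1 (neg_eq_zero.1 this.symm)).resolve_left htpos.ne'
  refine hx (funext (hT.connected.forall_of_adj hxu ?_))
  suffices H : ∀ a b, T.Adj a b → (x a = 0 ↔ x b = 0) from fun a b hab => (H a b hab).1
  refine hT.adj_cases u (fun a b H hab => (H hab.symm).symm) (fun a b h1 h2 => absurd h2 h1)
    fun a b hab hlt _ => ?_
  by_cases hab' : a = u ∧ b = w
  · rw [hab'.1, hab'.2, hxu, hxw]
  have := htight a b
  rw [hE hab hab' fun h2 => hne hlt h2.2, rootedWeight_of_lt h hab hlt,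
    rootedWeight_of_gt h hab hlt] at this
  exact eq_zero_iff_of_two_mul_eq_weights (hpos hab hlt hab') this

end Balanced

/-! ### Recognizing double brooms -/

section DoubleBroom

theorem doubleBroom_adj_inl_inl {d a b : ℕ} (i j : Fin (d + 1)) :
    (doubleBroom d a b).Adj (.inl i) (.inl j) ↔ (i : ℕ) + 1 = j ∨ (j : ℕ) + 1 = i := by
  simp only [doubleBroom, fromRel_adj, ne_eq, Sum.inl.injEq, and_iff_right_iff_imp]
  rintro h rfl
  omega

theorem doubleBroom_adj_inl_inr_inl {d a b : ℕ} (i : Fin (d + 1)) (j : Fin a) :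
    (doubleBroom d a b).Adj (.inl i) (.inr (.inl j)) ↔ (i : ℕ) = 1 := by
  simp [doubleBroom]

theorem doubleBroom_adj_inl_inr_inr {d a b : ℕ} (i : Fin (d + 1)) (j : Fin b) :
    (doubleBroom d a b).Adj (.inl i) (.inr (.inr j)) ↔ (i : ℕ) + 1 = d := by
  simp [doubleBroom]

theorem doubleBroom_not_adj_inr_inr {d a b : ℕ} (i j : Fin a ⊕ Fin b) :
    ¬ (doubleBroom d a b).Adj (.inr i) (.inr j) := by
  simp [doubleBroom]

theorem doubleBroom_connected {d a b : ℕ} (hd : 1 ≤ d) : (doubleBroom d a b).Connected := by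
  have hpath : ∀ k (hk : k < d + 1), (doubleBroom d a b).Reachable (.inl 0) (.inl ⟨k, hk⟩) := by
    intro k
    induction k with
    | zero => exact fun _ => Reachable.refl _
    | succ k ih =>
      intro hk
      exact (ih (by omega)).trans
        (Adj.reachable ((doubleBroom_adj_inl_inl _ _).2 (Or.inl rfl)))
  have : Nonempty (Fin (d + 1) ⊕ (Fin a ⊕ Fin b)) := ⟨.inl 0⟩
  suffices H : ∀ x, (doubleBroom d a b).Reachable (.inl 0) x from
    ⟨fun x y => (H x).symm.trans (H y)⟩
  rintro (i | j | j)
  · exact hpath i i.2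
  · exact (hpath 1 (by omega)).trans
      (Adj.reachable ((doubleBroom_adj_inl_inr_inl ⟨1, by omega⟩ _).2 rfl))
  · exact (hpath (d - 1) (by omega)).trans (Adj.reachable
      ((doubleBroom_adj_inl_inr_inr ⟨d - 1, by omega⟩ _).2 (Nat.sub_add_cancel hd)))

variable {V : Type*} [Fintype V] {T : SimpleGraph V}

/-- A surjective homomorphism from a connected graph onto a tree with as many vertices is an
isomorphism. -/
theorem SimpleGraph.IsTree.nonempty_iso_of_surjective (hT : T.IsTree) {W : Type*} [Fintype W]
    {G : SimpleGraph W} (hG : G.Connected) {f : W → V} (hf : Function.Surjective f)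
    (hcard : Fintype.card W = Fintype.card V) (hom : ∀ a b, G.Adj a b → T.Adj (f a) (f b)) :
    Nonempty (T ≃g G) := by
  set e : W ≃ V := Equiv.ofBijective f ((Fintype.bijective_iff_surjective_and_card f).2 ⟨hf, hcard⟩)
  have hle : G.map e.toEmbedding ≤ T := by
    rintro _ _ ⟨-, a, b, hab, rfl, rfl⟩
    exact hom a b hab
  have hconn : (G.map e.toEmbedding).Connected := (Iso.map e G).connected_iff.1 hG
  -- A tree is minimal among connected graphs on its vertex set, so the connected image is all of
  -- `T`.
  have hmin := (isTree_iff_minimal_connected.1 hT).eq_of_le hconn hle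
  exact ⟨(hmin ▸ Iso.map e G).symm⟩

theorem SimpleGraph.IsTree.nonempty_iso_doubleBroom (hT : T.IsTree) {d a b : ℕ} (hd : 1 ≤ d)
    (hcard : Fintype.card V = d + 1 + a + b) (p : Fin (d + 1) → V) {A B : Finset V}
    (hA : A.card = a) (hB : B.card = b) (hp : ∀ i : Fin d, T.Adj (p i.castSucc) (p i.succ))
    (hpA : ∀ x ∈ A, T.Adj (p ⟨1, by omega⟩) x) (hpB : ∀ x ∈ B, T.Adj (p ⟨d - 1, by omega⟩) x)
    (hclosed : ∀ x y, T.Adj x y → (∃ i, p i = x) ∨ x ∈ A ∨ x ∈ B →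
      (∃ i, p i = y) ∨ y ∈ A ∨ y ∈ B) :
    Nonempty (T ≃g doubleBroom d a b) := by
  set eA := A.equivFinOfCardEq hA
  set eB := B.equivFinOfCardEq hB
  set f : Fin (d + 1) ⊕ (Fin a ⊕ Fin b) → V :=
    Sum.elim p (Sum.elim (fun i => eA.symm i) (fun i => eB.symm i))
  refine hT.nonempty_iso_of_surjective (doubleBroom_connected hd) (f := f) ?_
    (by simp [hcard]; omega) ?_
  · intro x
    rcases hT.connected.forall_of_adj (r := p 0) (Or.inl ⟨0, rfl⟩) hclosed x with ⟨i, hi⟩ | hx | hx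
    · exact ⟨.inl i, hi⟩
    · exact ⟨.inr (.inl (eA ⟨x, hx⟩)), by simp [f]⟩
    · exact ⟨.inr (.inr (eB ⟨x, hx⟩)), by simp [f]⟩
  · have hpath : ∀ i j : Fin (d + 1), (i : ℕ) + 1 = j → T.Adj (p i) (p j) := fun i j hij => by
      have hi : i = Fin.castSucc ⟨i, by omega⟩ := rfl
      have hj : j = Fin.succ ⟨i, by omega⟩ := Fin.ext hij.symm
      have := hp ⟨i, by omega⟩
      rwa [← hi, ← hj] at this
    have hA' : ∀ (i : Fin (d + 1)) (j : Fin a), (i : ℕ) = 1 → T.Adj (p i) (eA.symm j) :=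
      fun i j hi => by
        have := hpA _ (eA.symm j).2
        convert this using 2
        exact Fin.ext hi
    have hB' : ∀ (i : Fin (d + 1)) (j : Fin b), (i : ℕ) + 1 = d → T.Adj (p i) (eB.symm j) :=
      fun i j hi => by
        have := hpB _ (eB.symm j).2
        convert this using 2
        exact Fin.ext (by simp; omega)
    rintro (i | i | i) (j | j | j) h
    · rcases (doubleBroom_adj_inl_inl i j).1 h with h | h
      · exact hpath i j h
      · exact (hpath j i h).symm
    · exact hA' i j ((doubleBroom_adj_inl_inr_inl i j).1 h)
    · exact hB' i j ((doubleBroom_adj_inl_inr_inr i j).1 h)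
    · exact (hA' j i ((doubleBroom_adj_inl_inr_inl j i).1 h.symm)).symm
    · exact absurd h (doubleBroom_not_adj_inr_inr _ _)
    · exact absurd h (doubleBroom_not_adj_inr_inr _ _)
    · exact (hB' j i ((doubleBroom_adj_inl_inr_inr j i).1 h.symm)).symm
    · exact absurd h (doubleBroom_not_adj_inr_inr _ _)
    · exact absurd h (doubleBroom_not_adj_inr_inr _ _)

/-- The branch at `m` through `c` is a star with centre `c` and `k` leaves. -/
def SimpleGraph.IsStarBranch (T : SimpleGraph V) (m c : V) (k : ℕ) : Prop :=
  T.Adj m c ∧ T.branchCard m c = k + 1 ∧ ∀ e, T.Adj c e → e ≠ m → T.branchCard c e = 1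

open Classical in
theorem SimpleGraph.IsStarBranch.exists_leaves (hT : T.IsTree) {m c : V} {k : ℕ}
    (h : T.IsStarBranch m c k) (hk : 1 ≤ k) :
    ∃ (l : V) (L : Finset V), L.card = k - 1 ∧ (∀ y, T.Adj c y ↔ y = m ∨ y = l ∨ y ∈ L) ∧
      ∀ e, e = l ∨ e ∈ L → ∀ y, T.Adj e y → y = c := by
  obtain ⟨hmc, hK, hleaf⟩ := h
  set S : Finset V := (Finset.univ.erase m).filter (T.Adj c) with hS
  have hmem : ∀ e, e ∈ S ↔ T.Adj c e ∧ e ≠ m := fun e => by simp [hS, and_comm]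
  have hcard : S.card = k := by
    have h1 := hT.sum_branchCard_erase hmc
    have h2 : ∑ w ∈ Finset.univ.erase m, T.branchCard c w = S.card := by
      rw [hS, Finset.card_filter]
      refine Finset.sum_congr rfl fun w hw => ?_
      split_ifs with hcw
      · exact hleaf w hcw (Finset.ne_of_mem_erase hw)
      · exact branchCard_of_not_adj hcw
    omega
  obtain ⟨l, hl⟩ := Finset.card_pos.1 (by omega : 0 < S.card)
  refine ⟨l, S.erase l, by rw [Finset.card_erase_of_mem hl, hcard], fun y => ?_,
    fun e he y hey => ?_⟩
  · rw [Finset.mem_erase, hmem]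
    have := (hmem l).1 hl
    by_cases hym : y = m
    · simp [hym, hmc.symm]
    · by_cases hyl : y = l
      · simp [hyl, this.1]
      · simp [hym, hyl]
  · have heS : T.Adj c e ∧ e ≠ m := by
      rcases he with rfl | he
      · exact (hmem _).1 hl
      · exact (hmem e).1 (Finset.mem_of_mem_erase he)
    by_contra hyc
    have h1 := hT.branchCard_lt heS.1 hyc
    have h2 := branchCard_pos hey
    have h3 := hleaf e heS.1 heS.2
    omega

/-- One of the `a + 1` leaves of a star branch becomes an end of the path, leaving `a` pendant
vertices; likewise for `b`. -/
theorem SimpleGraph.IsTree.nonempty_iso_doubleBroom_four (hT : T.IsTree) {r c₁ c₂ : V} {a b : ℕ}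
    (hcard : Fintype.card V = 5 + a + b) (h₁ : T.IsStarBranch r c₁ (a + 1))
    (h₂ : T.IsStarBranch r c₂ (b + 1)) (hr : ∀ y, T.Adj r y → y = c₁ ∨ y = c₂) :
    Nonempty (T ≃g doubleBroom 4 a b) := by
  obtain ⟨l₁, L₁, hL₁, hc₁, hl₁⟩ := h₁.exists_leaves hT (by omega)
  obtain ⟨l₂, L₂, hL₂, hc₂, hl₂⟩ := h₂.exists_leaves hT (by omega)
  have a₁ := (hc₁ l₁).2 (by simp)
  have a₂ := (hc₂ l₂).2 (by simp)
  refine hT.nonempty_iso_doubleBroom (by omega) hcard ![l₁, c₁, r, c₂, l₂] hL₁ hL₂ ?_ ?_ ?_ ?_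
  · simp [Fin.forall_fin_succ, a₁.symm, h₁.1.symm, h₂.1, a₂]
  · exact fun x hx => (hc₁ x).2 (by simp [hx])
  · exact fun x hx => (hc₂ x).2 (by simp [hx])
  · simp [Fin.exists_fin_succ]
    grind

theorem SimpleGraph.IsTree.nonempty_iso_doubleBroom_five (hT : T.IsTree) {r₁ r₂ c₁ c₂ : V}
    {a b : ℕ} (hcard : Fintype.card V = 6 + a + b) (h₁ : T.IsStarBranch r₁ c₁ (a + 1))
    (h₂ : T.IsStarBranch r₂ c₂ (b + 1)) (hr : T.Adj r₁ r₂)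
    (hr₁ : ∀ y, T.Adj r₁ y → y = c₁ ∨ y = r₂) (hr₂ : ∀ y, T.Adj r₂ y → y = c₂ ∨ y = r₁) :
    Nonempty (T ≃g doubleBroom 5 a b) := by
  obtain ⟨l₁, L₁, hL₁, hc₁, hl₁⟩ := h₁.exists_leaves hT (by omega)
  obtain ⟨l₂, L₂, hL₂, hc₂, hl₂⟩ := h₂.exists_leaves hT (by omega)
  have a₁ := (hc₁ l₁).2 (by simp)
  have a₂ := (hc₂ l₂).2 (by simp)
  refine hT.nonempty_iso_doubleBroom (by omega) hcard ![l₁, c₁, r₁, r₂, c₂, l₂] hL₁ hL₂ ?_ ?_ ?_ ?_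
  · simp [Fin.forall_fin_succ, a₁.symm, h₁.1.symm, h₂.1, a₂, hr]
  · exact fun x hx => (hc₁ x).2 (by simp [hx])
  · exact fun x hx => (hc₂ x).2 (by simp [hx])
  · simp [Fin.exists_fin_succ]
    grind

theorem SimpleGraph.IsTree.nonempty_iso_doubleBroom_six (hT : T.IsTree) {r r₁ r₂ c₁ c₂ : V}
    {a b : ℕ} (hcard : Fintype.card V = 7 + a + b) (h₁ : T.IsStarBranch r₁ c₁ (a + 1))
    (h₂ : T.IsStarBranch r₂ c₂ (b + 1)) (hrr₁ : T.Adj r r₁) (hrr₂ : T.Adj r r₂)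
    (hr : ∀ y, T.Adj r y → y = r₁ ∨ y = r₂)
    (hr₁ : ∀ y, T.Adj r₁ y → y = c₁ ∨ y = r) (hr₂ : ∀ y, T.Adj r₂ y → y = c₂ ∨ y = r) :
    Nonempty (T ≃g doubleBroom 6 a b) := by
  obtain ⟨l₁, L₁, hL₁, hc₁, hl₁⟩ := h₁.exists_leaves hT (by omega)
  obtain ⟨l₂, L₂, hL₂, hc₂, hl₂⟩ := h₂.exists_leaves hT (by omega)
  have a₁ := (hc₁ l₁).2 (by simp)
  have a₂ := (hc₂ l₂).2 (by simp)
  refine hT.nonempty_iso_doubleBroom (by omega) hcard ![l₁, c₁, r₁, r, r₂, c₂, l₂] hL₁ hL₂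
    ?_ ?_ ?_ ?_
  · simp [Fin.forall_fin_succ, a₁.symm, h₁.1.symm, h₂.1, a₂, hrr₁.symm, hrr₂]
  · exact fun x hx => (hc₁ x).2 (by simp [hx])
  · exact fun x hx => (hc₂ x).2 (by simp [hx])
  · simp [Fin.exists_fin_succ]
    grind

end DoubleBroom

/-! ### Upper bounds and extremal trees, by parity of the order -/

section Extremal

variable {V : Type*} [Fintype V] {T : SimpleGraph V}

theorem exists_centroid_odd (hT : T.IsTree) {s : ℕ} (hcard : Fintype.card V = 2 * s + 3) :
    ∃ r, (∀ c, T.branchCard r c ≤ s + 1) ∧ ∀ c, T.branchCard r c + 1 ≠ Fintype.card V := by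
  obtain ⟨r, hr⟩ := hT.exists_centroid
  have h : ∀ c, T.branchCard r c ≤ s + 1 := fun c => by have := hr c; omega
  exact ⟨r, h, fun c => by have := h c; omega⟩

variable [DecidableEq V]

theorem SimpleGraph.IsTree.branchCard_add_add_le (hT : T.IsTree) {u a b c : V} (hab : a ≠ b)
    (hac : a ≠ c) (hbc : b ≠ c) :
    T.branchCard u a + T.branchCard u b + T.branchCard u c + 1 ≤ Fintype.card V := by
  have h : ∑ v ∈ {a, b, c}, T.branchCard u v =
      T.branchCard u a + T.branchCard u b + T.branchCard u c := by
    rw [Finset.sum_insert (by simp [hab, hac]), Finset.sum_pair hbc, add_assoc]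
  rw [← hT.sum_branchCard u, ← h]
  exact Nat.add_le_add_right (Finset.sum_le_sum_of_subset (Finset.subset_univ _)) 1

theorem two_mul_sqrt_eq (a : ℝ) : 2 * √a = √(4 * a) := by
  rw [Real.sqrt_mul (by norm_num), show (4 : ℝ) = 2 ^ 2 by norm_num, Real.sqrt_sq (by norm_num)]

theorem xiTwo_compl_le_of_odd (hT : T.IsTree) (hTc : Tᶜ.Connected) (h1 : 1 < Fintype.card V)
    {s : ℕ} (hs : 1 ≤ s) (hcard : Fintype.card V = 2 * s + 3) : xiTwo Tᶜ h1 ≤ 2 * √s := by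
  obtain ⟨r, hr, hleaf⟩ := exists_centroid_odd hT hcard
  by_contra hlt
  have hs2 : √(s : ℝ) ^ 2 = s := Real.sq_sqrt (by positivity)
  exact hlt (xiTwo_compl_of_branchCard_le hT hTc h1 (Real.sqrt_pos.2 (by exact_mod_cast hs)) hleaf
    (fun c => by rw [hs2]; exact_mod_cast hr c) (not_le.1 hlt).le).1.le

/-- The eigenvector vanishes at `r` and has no zeros on any branch where its value next to `r` is
nonzero. Such a branch has `s + 1` vertices, and the eigenvalue equation at `r` forces at least two
of them. Two already exhaust the tree, and the sizes 1 or `s` allowed further down leave two shapes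
per branch. -/
theorem iso_of_xiTwo_compl_eq (hT : T.IsTree) (hTc : Tᶜ.Connected) (h1 : 1 < Fintype.card V)
    {s : ℕ} (hs : 1 ≤ s) (hcard : Fintype.card V = 2 * s + 3) (heq : 2 * √s ≤ xiTwo Tᶜ h1) :
    Nonempty (T ≃g doubleBroom 4 (s - 1) (s - 1)) ∨
      (2 ≤ s ∧ Nonempty (T ≃g doubleBroom 5 (s - 2) (s - 1))) ∨
      (2 ≤ s ∧ Nonempty (T ≃g doubleBroom 6 (s - 2) (s - 2))) := by
  have : Nontrivial V := Fintype.one_lt_card_iff_nontrivial.1 h1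
  obtain ⟨r, hr, hleaf⟩ := exists_centroid_odd hT hcard
  have hs2 : √(s : ℝ) ^ 2 = s := Real.sq_sqrt (by positivity)
  obtain ⟨-, x, hx, hxr, hEx, htight, hK, hK'⟩ := xiTwo_compl_of_branchCard_le hT hTc h1
    (Real.sqrt_pos.2 (by exact_mod_cast hs)) hleaf
    (fun c => by rw [hs2]; exact_mod_cast hr c) heq
  rw [hs2] at hK hK'
  have hKs : ∀ c, T.Adj r c → x c ≠ 0 → T.branchCard r c = s + 1 := fun c hc hxc => by
    exact_mod_cast hK c hc hxc
  have hKs' : ∀ p v, T.Adj p v → T.dist r p < T.dist r v → p ≠ r → x v ≠ 0 →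
      T.branchCard p v = 1 ∨ T.branchCard p v = s := fun p v a b c d => by
    exact_mod_cast hK' p v a b c d
  obtain ⟨c₁, hc₁, hx₁⟩ : ∃ c, T.Adj r c ∧ x c ≠ 0 := by
    by_contra! hcon
    refine hx (funext (hT.connected.forall_of_adj hxr fun u v huv hu => ?_))
    by_cases hvr : v = r
    · rw [hvr, hxr]; rfl
    by_cases hur : u = r
    · exact hcon v (hur ▸ huv)
    · exact htight u v huv hur hvr hu
  obtain ⟨c₂, hc₂, hx₂, hne⟩ : ∃ c, T.Adj r c ∧ x c ≠ 0 ∧ c₁ ≠ c := by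
    by_contra! hcon
    have h2 := congrFun hEx r
    rw [Pi.smul_apply, hxr, smul_zero, Matrix.mulVec, dotProduct, Finset.sum_eq_single c₁] at h2
    · have := two_le_eccMatrix_compl hT hTc hc₁
      rcases mul_eq_zero.1 h2 with h | h
      · linarith
      · exact hx₁ h
    · intro v _ hv
      by_cases hrv : T.Adj r v
      · by_cases hxv : x v = 0
        · rw [hxv, mul_zero]
        · exact absurd (hcon v hrv hxv).symm hv
      · rw [eccMatrix_compl_of_not_adj hT hrv, zero_mul]
    · simp
  -- Either all children of `c` are leaves, or one child carries all `s` remaining vertices. In the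
  -- latter case the branches below it are smaller than `s`, hence single leaves.
  have hside : ∀ c, T.Adj r c → x c ≠ 0 → T.IsStarBranch r c s ∨
      (2 ≤ s ∧ ∃ e, T.IsStarBranch c e (s - 1) ∧ ∀ y, T.Adj c y → y = e ∨ y = r) := by
    intro c hc hxc
    have hKc := hKs c hc hxc
    have hxe : ∀ e, T.Adj c e → e ≠ r → x e ≠ 0 := fun e hce her hxe =>
      hxc (htight e c hce.symm her hc.ne' hxe)
    have hde : ∀ e, T.Adj c e → e ≠ r → T.dist r c < T.dist r e := fun e hce her =>
      hT.dist_lt_of_adj hc (dist_root_lt hc) hce her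
    by_cases hall : ∀ e, T.Adj c e → e ≠ r → T.branchCard c e = 1
    · exact Or.inl ⟨hc, hKc, hall⟩
    · push Not at hall
      obtain ⟨e, hce, her, hKe⟩ := hall
      have hKe' : T.branchCard c e = s :=
        (hKs' c e hce (hde e hce her) hc.ne' (hxe e hce her)).resolve_left hKe
      refine Or.inr ⟨by omega, e, ⟨hce, by omega, fun f hef hfc => ?_⟩, fun y hcy => ?_⟩
      · have hdf := hT.dist_lt_of_adj hce (hde e hce her) hef hfc
        have hfr : f ≠ r := by rintro rfl; simp at hdf
        have hxf : x f ≠ 0 := fun h => hxe e hce her (htight f e hef.symm hfr her h)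
        have := hT.branchCard_lt hce hfc
        exact (hKs' e f hef hdf her hxf).resolve_right (by omega)
      · by_contra! hy
        have h2 := hT.branchCard_add_add_le (u := c) (Ne.symm hy.2) (Ne.symm her) hy.1
        have h3 := hT.branchCard_add hc
        have h4 := branchCard_pos hcy
        omega
  have hr' : ∀ y, T.Adj r y → y = c₁ ∨ y = c₂ := fun y hy => by
    by_contra! h
    have h2 := hT.branchCard_add_add_le (u := r) hne (Ne.symm h.1) (Ne.symm h.2)
    have h3 := hKs c₁ hc₁ hx₁
    have h4 := hKs c₂ hc₂ hx₂
    have h5 := branchCard_pos hy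
    omega
  have hs1 : s - 1 + 1 = s := by omega
  rcases hside c₁ hc₁ hx₁ with hA₁ | ⟨h2s, e₁, hB₁, hN₁⟩ <;>
    rcases hside c₂ hc₂ hx₂ with hA₂ | ⟨h2s, e₂, hB₂, hN₂⟩
  · exact Or.inl (hT.nonempty_iso_doubleBroom_four (by omega) (hs1.symm ▸ hA₁) (hs1.symm ▸ hA₂) hr')
  · have hs2 : s - 2 + 1 = s - 1 := by omega
    exact Or.inr (Or.inl ⟨h2s, hT.nonempty_iso_doubleBroom_five (by omega) (hs2.symm ▸ hB₂)
      (hs1.symm ▸ hA₁) hc₂.symm hN₂ hr'⟩)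
  · have hs2 : s - 2 + 1 = s - 1 := by omega
    exact Or.inr (Or.inl ⟨h2s, hT.nonempty_iso_doubleBroom_five (by omega) (hs2.symm ▸ hB₁)
      (hs1.symm ▸ hA₂) hc₁.symm hN₁ fun y hy => (hr' y hy).symm⟩)
  · have hs2 : s - 2 + 1 = s - 1 := by omega
    exact Or.inr (Or.inr ⟨h2s, hT.nonempty_iso_doubleBroom_six (by omega) (hs2.symm ▸ hB₁)
      (hs2.symm ▸ hB₂) hc₁ hc₂ hr' hN₁ hN₂⟩)

theorem xiTwo_compl_lt_or_iso_of_even (hT : T.IsTree) (hTc : Tᶜ.Connected)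
    (h1 : 1 < Fintype.card V) {m : ℕ} (hm : 2 ≤ m) (hcard : Fintype.card V = 2 * m) :
    xiTwo Tᶜ h1 < 2 * √((m : ℝ) - 3 / 2) ∨
      ∃ s, 1 ≤ s ∧ Nonempty (T ≃g doubleBroom 5 (s - 1) (s - 1)) := by
  have hmR : (2 : ℝ) ≤ m := by exact_mod_cast hm
  obtain ⟨r, hr⟩ := hT.exists_centroid
  by_cases hsmall : ∀ c, T.branchCard r c + 1 ≤ m
  · left
    -- Branches of size at most `m - 1` only require `θ² ≥ m - 2`. Any value strictly between `m -
    -- 2` and `m - 3/2` gives a strict bound and keeps `θ` positive for `m = 2`.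
    have hlt : 2 * √((m : ℝ) - 7 / 4) < 2 * √((m : ℝ) - 3 / 2) :=
      mul_lt_mul_of_pos_left (Real.sqrt_lt_sqrt (by linarith) (by linarith)) two_pos
    by_contra hge
    have hge' := not_lt.1 hge
    have hsq : √((m : ℝ) - 7 / 4) ^ 2 = m - 7 / 4 := Real.sq_sqrt (by linarith)
    have := (xiTwo_compl_of_branchCard_le hT hTc h1 (θ := √((m : ℝ) - 7 / 4))
      (Real.sqrt_pos.2 (by linarith)) (r := r) (fun c => by have := hsmall c; omega)
      (fun c => by
        have h3 : (T.branchCard r c : ℝ) + 1 ≤ m := by exact_mod_cast hsmall c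
        rw [hsq]; linarith) (hlt.le.trans hge')).1
    linarith
  push Not at hsmall
  obtain ⟨w, hw⟩ := hsmall
  have hKrw : T.branchCard r w = m := by have := hr w; omega
  have hrw : T.Adj r w := by
    by_contra h
    rw [branchCard_of_not_adj h] at hKrw; omega
  have hKwr : T.branchCard w r = m := by have := hT.branchCard_add hrw; omega
  -- Failure of the star condition at `u` gives a branch of `m - 1` vertices with only leaves below
  -- its centre; it exhausts the half of `u`.
  have hside : ∀ u w, T.Adj u w → T.branchCard u w = m →
      xiTwo Tᶜ h1 < 2 * √((m : ℝ) - 3 / 2) ∨ (3 ≤ m ∧ ∃ c, T.IsStarBranch u c (m - 3 + 1) ∧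
        ∀ y, T.Adj u y → y = c ∨ y = w) := by
    intro u w huw hK
    by_cases hstar : ∀ c, T.Adj u c → c ≠ w → T.branchCard u c + 1 = m → 2 ≤ T.branchCard u c →
        ∃ e, T.Adj c e ∧ e ≠ u ∧ 2 ≤ T.branchCard c e
    · exact Or.inl (xiTwo_compl_lt_of_balanced_edge hT hTc h1 hm hcard huw hK hstar)
    · push Not at hstar
      obtain ⟨c, huc, hcw, hKc, hKc2, hall⟩ := hstar
      refine Or.inr ⟨by omega, c, ⟨huc, by omega, fun e hce heu => ?_⟩, fun y hy => ?_⟩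
      · have h2 := hall e hce heu
        have h3 := branchCard_pos hce
        omega
      · by_contra! h
        have h2 := hT.branchCard_add_add_le (u := u) hcw (Ne.symm h.1) (Ne.symm h.2)
        have h3 := branchCard_pos hy
        omega
  rcases hside r w hrw hKrw with h | ⟨h3, c, hc, hN⟩
  · exact Or.inl h
  rcases hside w r hrw.symm hKwr with h | ⟨-, c', hc', hN'⟩
  · exact Or.inl h
  · refine Or.inr ⟨m - 2, by omega, ?_⟩
    rw [show m - 2 - 1 = m - 3 by omega]
    exact hT.nonempty_iso_doubleBroom_five (by omega) hc hc' hrw hN hN'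

end Extremal

/-! ### Eigenvectors of double brooms -/

/-- The two path ends have unique neighbours, which are distinct and nonadjacent for `d ≥ 4`, so no
single edge reaches both ends. Hence all matrix entries on edges are 2. -/
theorem doubleBroom_not_isDominatingEdge {d a b : ℕ} (hd : 4 ≤ d)
    (x y : Fin (d + 1) ⊕ (Fin a ⊕ Fin b)) : ¬ (doubleBroom d a b).IsDominatingEdge x y := by
  have h0 : ∀ z, (doubleBroom d a b).Adj z (.inl 0) →
      z = .inl ⟨1, by omega⟩ := by
    rintro (i | j | j) h
    · have := (doubleBroom_adj_inl_inl _ _).1 h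
      simp only [Fin.val_zero] at this
      exact congrArg _ (Fin.ext (by simp; omega))
    · have := (doubleBroom_adj_inl_inr_inl _ _).1 h.symm
      simp at this
    · have := (doubleBroom_adj_inl_inr_inr _ _).1 h.symm
      simp only [Fin.val_zero] at this
      omega
  have h1 : ∀ z, (doubleBroom d a b).Adj z (.inl (Fin.last d)) →
      z = .inl ⟨d - 1, by omega⟩ := by
    rintro (i | j | j) h
    · have := (doubleBroom_adj_inl_inl _ _).1 h
      simp only [Fin.val_last] at this
      exact congrArg _ (Fin.ext (by simp; omega))
    · have := (doubleBroom_adj_inl_inr_inl _ _).1 h.symm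
      simp only [Fin.val_last] at this
      omega
    · have := (doubleBroom_adj_inl_inr_inr _ _).1 h.symm
      simp at this
  have hne : ¬ (doubleBroom d a b).Adj (.inl ⟨1, by omega⟩) (.inl ⟨d - 1, by omega⟩) := fun h => by
    have := (doubleBroom_adj_inl_inl _ _).1 h
    simp only at this
    omega
  have hne' : (1 : ℕ) ≠ d - 1 := by omega
  rintro ⟨hxy, h⟩
  rcases h (.inl 0) with h2 | h2 <;> rcases h (.inl (Fin.last d)) with h3 | h3 <;>
    have h2 := h0 _ h2 <;> have h3 := h1 _ h3
  · rw [h2] at h3; simp [hne'] at h3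
  · rw [h2, h3] at hxy; exact hne hxy
  · rw [h2, h3] at hxy; exact hne hxy.symm
  · rw [h2] at h3; simp [hne'] at h3

section Eigenvector

variable {V : Type*} {T : SimpleGraph V}

theorem eccMatrix_compl_of_iso_doubleBroom [Nontrivial V] (hT : T.IsTree) (hTc : Tᶜ.Connected)
    {d a b : ℕ} (hd : 4 ≤ d) (e : T ≃g doubleBroom d a b) {u v : V} (huv : T.Adj u v) :
    eccMatrix Tᶜ u v = 2 := by
  refine eccMatrix_compl_of_not_isDominatingEdge hT hTc huv fun h =>
    doubleBroom_not_isDominatingEdge hd (e u) (e v) ⟨e.map_adj_iff.2 h.1, fun w => ?_⟩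
  rw [← e.apply_symm_apply w, e.map_adj_iff, e.map_adj_iff]
  exact h.2 _

variable [Fintype V]

open Classical in
theorem eccMatrix_compl_mulVec [Nontrivial V] (hT : T.IsTree)
    (hE : ∀ u v, T.Adj u v → eccMatrix Tᶜ u v = 2) (f : V → ℝ) (u : V) :
    (eccMatrix Tᶜ).mulVec f u = 2 * ∑ v, if T.Adj u v then f v else 0 := by
  rw [Matrix.mulVec, dotProduct, Finset.mul_sum]
  refine Finset.sum_congr rfl fun v _ => ?_
  split_ifs with h
  · rw [hE u v h]
  · rw [eccMatrix_compl_of_not_adj hT h, zero_mul, mul_zero]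

open Classical in
/-- A function on the double broom that is constant on each of the two sets of pendant vertices
yields an eigenvector of the eccentricity matrix if it satisfies the eigenvalue equations. -/
theorem eccMatrix_compl_mulVec_doubleBroom [Nontrivial V] (hT : T.IsTree) (hTc : Tᶜ.Connected)
    {d a b : ℕ} (hd : 4 ≤ d) (e : T ≃g doubleBroom d a b) {P : Fin (d + 1) → ℝ} {α β θ : ℝ}
    (hP : ∀ i : Fin (d + 1), (∑ j : Fin (d + 1),
        if (i : ℕ) + 1 = j ∨ (j : ℕ) + 1 = i then P j else 0) +
      ((if (i : ℕ) = 1 then a * α else 0) + if (i : ℕ) + 1 = d then b * β else 0) = θ * P i)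
    (hα : P ⟨1, by omega⟩ = θ * α) (hβ : P ⟨d - 1, by omega⟩ = θ * β) :
    (eccMatrix Tᶜ).mulVec (Sum.elim P (Sum.elim (fun _ => α) fun _ => β) ∘ e) =
      (2 * θ) • (Sum.elim P (Sum.elim (fun _ => α) fun _ => β) ∘ e) := by
  funext u
  set F : Fin (d + 1) ⊕ (Fin a ⊕ Fin b) → ℝ := Sum.elim P (Sum.elim (fun _ => α) fun _ => β)
  rw [eccMatrix_compl_mulVec hT fun u v => eccMatrix_compl_of_iso_doubleBroom hT hTc hd e,
    Pi.smul_apply, smul_eq_mul, mul_assoc]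
  congr 1
  have hsum : (∑ v, if T.Adj u v then (F ∘ e) v else 0) =
      ∑ y, if (doubleBroom d a b).Adj (e u) y then F y else 0 := by
    rw [← e.toEquiv.sum_comp]
    refine Finset.sum_congr rfl fun v _ => ?_
    have : (doubleBroom d a b).Adj (e u) (e.toEquiv v) ↔ T.Adj u v := e.map_adj_iff
    simp only [this]
    rfl
  rw [hsum, Function.comp_apply]
  generalize e u = x
  rw [Fintype.sum_sum_type, Fintype.sum_sum_type]
  rcases x with i | j | j
  · simp only [doubleBroom_adj_inl_inl, doubleBroom_adj_inl_inr_inl, doubleBroom_adj_inl_inr_inr]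
    rw [← show _ = θ * F (.inl i) from hP i]
    simp [F]
  · have hl : ∀ i, (doubleBroom d a b).Adj (.inr (.inl j)) (.inl i) ↔ i = ⟨1, by omega⟩ :=
      fun i => by
      rw [adj_comm, doubleBroom_adj_inl_inr_inl, Fin.ext_iff]
    simp only [doubleBroom_not_adj_inr_inr, hl, if_false, Finset.sum_const_zero, add_zero]
    rw [Finset.sum_ite_eq', if_pos (Finset.mem_univ _)]
    exact hα
  · have hl : ∀ i, (doubleBroom d a b).Adj (.inr (.inr j)) (.inl i) ↔ i = ⟨d - 1, by omega⟩ :=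
      fun i => by
        rw [adj_comm, doubleBroom_adj_inl_inr_inr, Fin.ext_iff]
        simp only
        omega
    simp only [doubleBroom_not_adj_inr_inr, hl, if_false, Finset.sum_const_zero, add_zero]
    rw [Finset.sum_ite_eq', if_pos (Finset.mem_univ _)]
    exact hβ

variable [DecidableEq V]

theorem le_xiTwo_compl_doubleBroom (hT : T.IsTree) (hTc : Tᶜ.Connected) (h1 : 1 < Fintype.card V)
    {d a b : ℕ} (hd : 4 ≤ d) (e : T ≃g doubleBroom d a b) {P : Fin (d + 1) → ℝ} {α β θ : ℝ}
    (hP : ∀ i : Fin (d + 1), (∑ j : Fin (d + 1),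
        if (i : ℕ) + 1 = j ∨ (j : ℕ) + 1 = i then P j else 0) +
      ((if (i : ℕ) = 1 then a * α else 0) + if (i : ℕ) + 1 = d then b * β else 0) = θ * P i)
    (hα : P ⟨1, by omega⟩ = θ * α) (hβ : P ⟨d - 1, by omega⟩ = θ * β)
    {i j : Fin (d + 1)} (hi : 0 < P i) (hj : P j < 0) : 2 * θ ≤ xiTwo Tᶜ h1 := by
  have : Nontrivial V := Fintype.one_lt_card_iff_nontrivial.1 h1
  refine le_second_eigenvalue_of_sign_change (eccMatrix_isHermitian Tᶜ) h1 (eccMatrix_nonneg _)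
    (eccMatrix_compl_mulVec_doubleBroom hT hTc hd e hP hα hβ)
    (p := e.symm (.inl i)) (q := e.symm (.inl j)) ?_ ?_
  · simpa using hi
  · simpa using hj

open Classical in
/-- An eigenvector without zeros that changes sign on one edge only, and takes opposite values
there, belongs to an eigenvalue that is at least the second largest one. -/
theorem xiTwo_compl_le_of_eigenvector (hT : T.IsTree) (h1 : 1 < Fintype.card V)
    (hE : ∀ u v, T.Adj u v → eccMatrix Tᶜ u v = 2) {f : V → ℝ} {θ : ℝ}
    (hf : (eccMatrix Tᶜ).mulVec f = (2 * θ) • f) (hf0 : ∀ v, f v ≠ 0) {p q : V}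
    (hpq : f p = -f q)
    (hsign : ∀ u v, T.Adj u v → 0 < f u * f v ∨ (u = p ∧ v = q) ∨ (u = q ∧ v = p)) :
    xiTwo Tᶜ h1 ≤ 2 * θ := by
  have : Nontrivial V := Fintype.one_lt_card_iff_nontrivial.1 h1
  by_contra hlt
  -- With weights `f v / f u` the eigenvalue equation makes every vertex sum exactly `θ`. On the
  -- edge `pq` both weights are `-1`, and `x p = -x q` turns the edge inequality into an equality.
  set ψ : (V → ℝ) →ₗ[ℝ] ℝ :=
    LinearMap.proj (R := ℝ) (φ := fun _ : V => ℝ) p + LinearMap.proj q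
  refine hlt (eigenvector_of_weights (eccMatrix_isHermitian Tᶜ) h1
    ψ (g := fun u v => if T.Adj u v then f v / f u else 0)
    ?_ ?_ (not_le.1 hlt).le).1.le
  · intro x hx u v
    have hx : x p + x q = 0 := hx
    by_cases huv : T.Adj u v
    · rw [hE u v huv, if_pos huv, if_pos huv.symm]
      rcases hsign u v huv with h | h
      · rw [← inv_div (f v) (f u)]
        refine two_mul_le_weights ?_ _ _
        rcases mul_pos_iff.1 h with h | h
        · exact div_pos h.2 h.1
        · exact div_pos_of_neg_of_neg h.2 h.1
      · have hd : f u = -f v ∧ x u = -x v := by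
          rcases h with ⟨rfl, rfl⟩ | ⟨rfl, rfl⟩
          · exact ⟨hpq, by linarith⟩
          · exact ⟨by linarith, by linarith⟩
        rw [hd.1, hd.2, div_neg, neg_div, div_self (hf0 v)]
        apply le_of_eq; ring
    · rw [eccMatrix_compl_of_not_adj hT huv, if_neg huv, if_neg fun h => huv h.symm]
      simp
  · intro u
    have h2 := congrFun hf u
    rw [eccMatrix_compl_mulVec hT hE, Pi.smul_apply, smul_eq_mul, mul_assoc] at h2
    have h3 := mul_left_cancel₀ two_ne_zero h2
    have h4 : (∑ v, if T.Adj u v then f v / f u else 0) =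
        (∑ v, if T.Adj u v then f v else 0) / f u := by
      rw [Finset.sum_div]
      refine Finset.sum_congr rfl fun v _ => ?_
      split_ifs <;> simp
    rw [h4, h3, mul_div_cancel_right₀ _ (hf0 u)]

end Eigenvector

/-! ### Attaining the bound, and the exceptional tree -/

section Values

variable {V : Type*} [Fintype V] [DecidableEq V] {T : SimpleGraph V}

theorem le_xiTwo_compl_doubleBroom_four (hT : T.IsTree) (hTc : Tᶜ.Connected)
    (h1 : 1 < Fintype.card V) {s : ℕ} (hs : 1 ≤ s) (e : T ≃g doubleBroom 4 (s - 1) (s - 1)) :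
    2 * √s ≤ xiTwo Tᶜ h1 := by
  have hs2 : √(s : ℝ) * √s = s := Real.mul_self_sqrt (by positivity)
  have hc : ((s - 1 : ℕ) : ℝ) = s - 1 := by push_cast [hs]; ring
  -- The vector vanishes at the centre and is antisymmetric; on each side it is the Perron vector of
  -- a star with `s` leaves.
  refine le_xiTwo_compl_doubleBroom hT hTc h1 (by norm_num) e (P := ![1, √s, 0, -√s, -1])
    (α := 1) (β := -1) (i := 0) (j := 4) ?_ ?_ ?_ (by simp) (by simp)
  · intro i
    fin_cases i <;> simp [Fin.sum_univ_succ, hc] <;> linarith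
  · simp
  · simp

theorem le_xiTwo_compl_doubleBroom_five (hT : T.IsTree) (hTc : Tᶜ.Connected)
    (h1 : 1 < Fintype.card V) {s : ℕ} (hs : 2 ≤ s) (e : T ≃g doubleBroom 5 (s - 2) (s - 1)) :
    2 * √s ≤ xiTwo Tᶜ h1 := by
  have hs2 : √(s : ℝ) * √s = s := Real.mul_self_sqrt (by positivity)
  have hs0 : (0 : ℝ) < s := by positivity
  have hc : ((s - 1 : ℕ) : ℝ) = s - 1 := by push_cast [show 1 ≤ s by omega]; ring
  have hc' : ((s - 2 : ℕ) : ℝ) = s - 2 := by push_cast [hs]; ring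
  -- Removing `v₃` leaves two stars with `s` leaves, `v₃` being attached to a leaf of one and the
  -- centre of the other. Scaling one side by `√s` makes the values next to `v₃` cancel.
  refine le_xiTwo_compl_doubleBroom hT hTc h1 (by norm_num) e (P := ![√s, s, √s, 0, -√s, -1])
    (α := √s) (β := -1) (i := 1) (j := 5) ?_ ?_ ?_ (by simpa using hs0) (by simp)
  · intro i
    fin_cases i <;> simp [Fin.sum_univ_succ, hc, hc'] <;> linarith
  · simp
  · simp

theorem le_xiTwo_compl_doubleBroom_six (hT : T.IsTree) (hTc : Tᶜ.Connected)
    (h1 : 1 < Fintype.card V) {s : ℕ} (hs : 2 ≤ s) (e : T ≃g doubleBroom 6 (s - 2) (s - 2)) :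
    2 * √s ≤ xiTwo Tᶜ h1 := by
  have hs2 : √(s : ℝ) * √s = s := Real.mul_self_sqrt (by positivity)
  have hc' : ((s - 2 : ℕ) : ℝ) = s - 2 := by push_cast [hs]; ring
  refine le_xiTwo_compl_doubleBroom hT hTc h1 (by norm_num) e (P := ![1, √s, 1, 0, -1, -√s, -1])
    (α := 1) (β := -1) (i := 0) (j := 6) ?_ ?_ ?_ (by simp) (by simp)
  · intro i
    fin_cases i <;> simp [Fin.sum_univ_succ, hc'] <;> linarith
  · simp
  · simp

theorem exists_unique_pos_root {s : ℕ} (hs : 1 ≤ s) : ∃ x : ℝ,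
    (0 < x ∧ x ^ 3 + x ^ 2 - ((s : ℝ) + 1) * x - s = 0) ∧
      (∀ y : ℝ, 0 < y → y ^ 3 + y ^ 2 - ((s : ℝ) + 1) * y - s = 0 → y = x) ∧
      √((s : ℝ) + 1 / 2) < x := by
  have hs1 : (1 : ℝ) ≤ s := by exact_mod_cast hs
  set t : ℝ := √((s : ℝ) + 1 / 2) with ht
  have ht2 : t ^ 2 = s + 1 / 2 := Real.sq_sqrt (by linarith)
  have ht1 : 1 < t := by
    rw [ht, Real.lt_sqrt (by norm_num)]; linarith
  -- At `t² = s + 1/2` the cubic equals `(1 - t) / 2`, which places the root above `t`.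
  have hft : t ^ 3 + t ^ 2 - ((s : ℝ) + 1) * t - s < 0 := by
    have : t ^ 3 + t ^ 2 - ((s : ℝ) + 1) * t - s = (1 - t) / 2 := by
      rw [pow_succ t 2, ht2]; ring
    rw [this]; linarith
  have hcont : ContinuousOn (fun x : ℝ => x ^ 3 + x ^ 2 - ((s : ℝ) + 1) * x - s)
      (Set.Icc t (s + 1)) := by fun_prop
  have hle : t ≤ (s : ℝ) + 1 := by nlinarith
  obtain ⟨x, hx, hfx⟩ := intermediate_value_Icc hle hcont
    (show (0 : ℝ) ∈ Set.Icc _ _ from ⟨hft.le, by nlinarith⟩)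
  simp only at hfx
  have htx : t < x := lt_of_le_of_ne hx.1 fun h => by rw [h] at hft; linarith
  have hx0 : 0 < x := by linarith
  refine ⟨x, ⟨hx0, hfx⟩, fun y hy hfy => ?_, htx⟩
  -- This combination of the two equations encodes that the cubic divided by its variable is
  -- strictly increasing on the positive axis.
  have key : (y - x) * (y * x * (y + x + 1) + s) = 0 := by linear_combination x * hfy - y * hfx
  have hpos : 0 < y * x * (y + x + 1) + s := by positivity
  linarith [(mul_eq_zero.1 key).resolve_right hpos.ne']

theorem xiTwo_compl_doubleBroom_five_eq (hT : T.IsTree) (hTc : Tᶜ.Connected)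
    (h1 : 1 < Fintype.card V) {s : ℕ} (hs : 1 ≤ s) (e : T ≃g doubleBroom 5 (s - 1) (s - 1))
    {x : ℝ} (hx : 0 < x) (hroot : x ^ 3 + x ^ 2 - ((s : ℝ) + 1) * x - s = 0) :
    xiTwo Tᶜ h1 = 2 * x := by
  have : Nontrivial V := Fintype.one_lt_card_iff_nontrivial.1 h1
  have hc : ((s - 1 : ℕ) : ℝ) = s - 1 := by push_cast [hs]; ring
  obtain ⟨c, hcx⟩ : ∃ c, c = x + 1 := ⟨_, rfl⟩
  have h1x : 0 < c := by linarith
  -- An antisymmetric vector, changing sign only on the middle edge. The equation at `v₂` gives `c =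
  -- x + 1`, and the one at `v₁` is then the cubic.
  set P : Fin 6 → ℝ := ![c, x * c, x, -x, -(x * c), -c] with hPd
  have hP : ∀ i : Fin 6, (∑ j : Fin 6, if (i : ℕ) + 1 = j ∨ (j : ℕ) + 1 = i then P j else 0) +
      ((if (i : ℕ) = 1 then ((s - 1 : ℕ) : ℝ) * c else 0) +
        if (i : ℕ) + 1 = 5 then ((s - 1 : ℕ) : ℝ) * (-c) else 0) = x * P i := by
    intro i
    fin_cases i <;> simp [Fin.sum_univ_succ, hc, hPd] <;> rw [hcx] <;> linarith
  refine le_antisymm ?_ (le_xiTwo_compl_doubleBroom hT hTc h1 (by norm_num) e hP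
    (by simp [hPd]) (by simp [hPd]) (i := 0) (j := 5) (by simp [hPd]; linarith)
    (by simp [hPd]; linarith))
  refine xiTwo_compl_le_of_eigenvector hT h1
    (fun u v => eccMatrix_compl_of_iso_doubleBroom hT hTc (by norm_num) e)
    (eccMatrix_compl_mulVec_doubleBroom hT hTc (by norm_num) e hP
      (by simp [hPd]) (by simp [hPd])) ?_ (p := e.symm (.inl 2)) (q := e.symm (.inl 3)) ?_ ?_
  · intro v
    rw [Function.comp_apply]
    rcases e v with i | j | j
    · fin_cases i <;> simp [hPd, hx.ne', h1x.ne']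
    · simpa using h1x.ne'
    · simpa using h1x.ne'
  · simp [hPd]
  · intro u v huv
    have huv' := e.map_adj_iff.2 huv
    rw [RelIso.eq_symm_apply, RelIso.eq_symm_apply,
      RelIso.eq_symm_apply, RelIso.eq_symm_apply,
      Function.comp_apply, Function.comp_apply]
    revert huv'
    generalize e u = y
    generalize e v = z
    have hpend : 0 < x * c * c := by positivity
    rcases y with i | i | i <;> rcases z with k | k | k <;> intro hyz
    · have hik := (doubleBroom_adj_inl_inl _ _).1 hyz
      fin_cases i <;> fin_cases k <;> simp [hPd] at hik ⊢ <;> positivity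
    · obtain rfl : i = 1 := Fin.ext ((doubleBroom_adj_inl_inr_inl _ _).1 hyz)
      exact Or.inl (by simpa [hPd] using hpend)
    · obtain rfl : i = 4 := Fin.ext (by
        have := (doubleBroom_adj_inl_inr_inr _ _).1 hyz
        simp; omega)
      exact Or.inl (by simp [hPd]; linarith)
    · obtain rfl : k = 1 := Fin.ext ((doubleBroom_adj_inl_inr_inl _ _).1 hyz.symm)
      exact Or.inl (by simp [hPd]; linarith)
    · exact absurd hyz (doubleBroom_not_adj_inr_inr _ _)
    · exact absurd hyz (doubleBroom_not_adj_inr_inr _ _)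
    · obtain rfl : k = 4 := Fin.ext (by
        have := (doubleBroom_adj_inl_inr_inr _ _).1 hyz.symm
        simp; omega)
      exact Or.inl (by simp [hPd]; linarith)
    · exact absurd hyz (doubleBroom_not_adj_inr_inr _ _)
    · exact absurd hyz (doubleBroom_not_adj_inr_inr _ _)

end Values

/-! ### Assembling the two parities and the exceptional tree -/

theorem mainTheorem7 {V : Type*} [Fintype V] [DecidableEq V] (n : ℕ) (hn : 4 ≤ n)
    (hV : Fintype.card V = n) (T : SimpleGraph V) (hT : T.IsTree) (hTc : Tᶜ.Connected) :
    ((¬ ∃ s : ℕ, 1 ≤ s ∧ Nonempty (T ≃g doubleBroom 5 (s - 1) (s - 1))) →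
      xiTwo Tᶜ (by omega) ≤ √(2 * ((n : ℝ) - 3)) ∧
      (xiTwo Tᶜ (by omega) = √(2 * ((n : ℝ) - 3)) ↔
        ∃ s : ℕ, 1 ≤ s ∧ n = 2 * s + 3 ∧
          (Nonempty (T ≃g doubleBroom 4 (s - 1) (s - 1)) ∨
            (2 ≤ s ∧ Nonempty (T ≃g doubleBroom 5 (s - 2) (s - 1))) ∨
            (2 ≤ s ∧ Nonempty (T ≃g doubleBroom 6 (s - 2) (s - 2)))))) ∧
    (∀ s : ℕ, 1 ≤ s → Nonempty (T ≃g doubleBroom 5 (s - 1) (s - 1)) →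
      ∃ x : ℝ, (0 < x ∧ x ^ 3 + x ^ 2 - ((s : ℝ) + 1) * x - s = 0) ∧
        (∀ y : ℝ, 0 < y → y ^ 3 + y ^ 2 - ((s : ℝ) + 1) * y - s = 0 → y = x) ∧
        xiTwo Tᶜ (by omega) = 2 * x ∧ √(2 * ((n : ℝ) - 3)) < 2 * x) := by
  have h1 : 1 < Fintype.card V := by omega
  refine ⟨fun hnot => ?_, fun s hs hiso => ?_⟩
  · rcases Nat.even_or_odd' n with ⟨m, hm | hm⟩
    · have hsq : √(2 * ((n : ℝ) - 3)) = 2 * √((m : ℝ) - 3 / 2) := by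
        rw [two_mul_sqrt_eq, hm]
        congr 1; push_cast; ring
      have hlt := (xiTwo_compl_lt_or_iso_of_even hT hTc h1 (m := m) (by omega)
        (by omega)).resolve_right hnot
      rw [hsq]
      exact ⟨hlt.le, fun heq => absurd heq hlt.ne, fun ⟨s, _, h, _⟩ => by omega⟩
    · obtain ⟨s, rfl⟩ : ∃ s, m = s + 1 := ⟨m - 1, by omega⟩
      have hcard : Fintype.card V = 2 * s + 3 := by omega
      have hs : 1 ≤ s := by omega
      have hsq : √(2 * ((n : ℝ) - 3)) = 2 * √s := by
        rw [two_mul_sqrt_eq, hm]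
        congr 1; push_cast; ring
      have hle := xiTwo_compl_le_of_odd hT hTc h1 hs hcard
      rw [hsq]
      refine ⟨hle, fun heq => ⟨s, hs, by omega, ?_⟩, ?_⟩
      · exact iso_of_xiTwo_compl_eq hT hTc h1 hs hcard heq.ge
      · rintro ⟨s', -, hs', h⟩
        obtain rfl : s' = s := by omega
        refine le_antisymm hle ?_
        rcases h with ⟨⟨e⟩⟩ | ⟨h2, ⟨e⟩⟩ | ⟨h2, ⟨e⟩⟩
        · exact le_xiTwo_compl_doubleBroom_four hT hTc h1 hs e
        · exact le_xiTwo_compl_doubleBroom_five hT hTc h1 h2 e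
        · exact le_xiTwo_compl_doubleBroom_six hT hTc h1 h2 e
  · obtain ⟨e⟩ := hiso
    obtain ⟨x, hx, huniq, hlt⟩ := exists_unique_pos_root hs
    refine ⟨x, hx, huniq, xiTwo_compl_doubleBroom_five_eq hT hTc h1 hs e hx.1 hx.2, ?_⟩
    have hn' : n = 2 * s + 4 := by
      have h2 := Fintype.card_congr e.toEquiv
      simp only [Fintype.card_sum, Fintype.card_fin] at h2
      omega
    have hsq : √(2 * ((n : ℝ) - 3)) = 2 * √((s : ℝ) + 1 / 2) := by
      rw [two_mul_sqrt_eq, hn']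
      congr 1; push_cast; ring
    rw [hsq]
    linarith
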